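/- **Theorem 4.2 (solvability of the inverse problem).** Let $k\ge 1$ be an integer, $a=\pi/k$, $\alpha,\beta\in\{0,1\}$. For complex-valued $q\in L_2(0,\pi)$ let $L(q,a,\alpha,\beta)$ be the boundary value problem $$-y''(x)+q(x)\,y(a)=\lambda y(x),\quad 0<x<\pi,\qquad y^{(\alpha)}(0)=y^{(\beta)}(\pi)=0,$$ where solutions are functions $y$ such that $y,y'$ are absolutely continuous on $[0,\pi]$ and the equation holds almost everywhere. Let $C(x,\lambda),S(x,\lambda)$ be the solutions of the equation with $C(a,\lambda)=S'(a,\lambda)=1$, $S(a,\lambda)=C'(a,\lambda)=0$ (primes and bracketed superscripts denote derivatives in $x$), and put $\Delta_{\alpha,\beta}(\lambda)=C^{(\alpha)}(0,\lambda)S^{(\beta)}(\pi,\lambda)-S^{(\alpha)}(0,\lambda)C^{(\beta)}(\pi,\lambda)$. A sequence $\{\lambda_n\}_{n\ge1}$ is called the spectrum of $L(q,a,\alpha,\beta)$ if its terms are exactly the eigenvalues of this problem (the $\lambda\in\mathbb C$ for which it has a nontrivial solution), each repeated according to its multiplicity as a zero of the entire function $\Delta_{\alpha,\beta}$. Let $\{\lambda_n\}_{n\ge1}$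 be an arbitrary sequence of complex numbers of the form $$\lambda_n=\Big(n-\frac{\alpha+\beta}{2}+\frac{\kappa_n}{n}\Big)^2,\qquad \{\kappa_n\}_{n\ge1}\in\ell_2 .\tag{1}$$ (I) Non-degenerate case. Suppose that $\alpha=0,\ \beta=1$; or $\alpha=1,\ \beta=0$ and $k$ is even; or $\alpha=\beta=1$ and $k$ is odd. Then there exists $q\in L_2(0,\pi)$ such that $\{\lambda_n\}_{n\ge1}$ is the spectrum of $L(q,\pi/k,\alpha,\beta)$. (II) Degenerate case. Suppose that one of the following holds: (i) $\alpha=\beta=0$ and $\lambda_{kn}=(kn)^2$ for all $n\in\mathbb N$; (ii) $\alpha=1,\ \beta=0$, $k$ is odd and $\lambda_{k(n-1/2)+1/2}=k^2(n-\tfrac12)^2$ for all $n\in\mathbb N$; (iii) $\alpha=\beta=1$, $k$ is even and $\lambda_{k(n-1/2)+1}=k^2(n-\tfrac12)^2$ for all $n\in\mathbb N$. Here $\mathbb N=\{1,2,\dots\}$. Then there exists $q\in L_2(0,\pi)$ such that $\{\lambda_n\}_{n\ge1}$ is the spectrum of $L(q,\pi/k,\alpha,\beta)$, and such $q$ is not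 unique: there are at least two of them that do not coincide almost everywhere on $(0,\pi)$. -/

import Mathlib

open Set MeasureTheory

noncomputable section

/-- The class `L₂(0,π)` of complex-valued functions. -/
def FrozenSL.IsL2 (q : ℝ → ℂ) : Prop :=
  MemLp q 2 (volume.restrict (Ioo 0 Real.pi))

/-- The `m`-th derivative `y^(m)(x)` on the segment `[0,π]` (one-sided at the end points). -/
def FrozenSL.der (m : ℕ) (y : ℝ → ℂ) (x : ℝ) : ℂ :=
  iteratedDerivWithin m y (Icc 0 Real.pi) x

/-- `y` is a solution on `[0,π]` of the equation with frozen argument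
`-y''(x) + q(x) y(a) = z y(x)`, in the usual sense: `y` is differentiable on `[0,π]`, and `y'` is
absolutely continuous with `y''(x) = q(x) y(a) - z y(x)` almost everywhere, that is, `y'` is the
indefinite integral of this function. -/
structure FrozenSL.IsSolution (q : ℝ → ℂ) (a : ℝ) (z : ℂ) (y : ℝ → ℂ) : Prop where
  differentiableOn : DifferentiableOn ℝ y (Icc 0 Real.pi)
  der_eq : ∀ x ∈ Icc (0 : ℝ) Real.pi,
    FrozenSL.der 1 y x = FrozenSL.der 1 y 0 + ∫ t in (0 : ℝ)..x, (q t * y a - z * y t)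

/-- `z` is an eigenvalue of the boundary value problem `L(q,a,α,β)`: the equation has a nontrivial
solution with `y^(α)(0) = y^(β)(π) = 0`. -/
def FrozenSL.IsEigenvalue (q : ℝ → ℂ) (a : ℝ) (α β : ℕ) (z : ℂ) : Prop :=
  ∃ y : ℝ → ℂ, FrozenSL.IsSolution q a z y ∧
    FrozenSL.der α y 0 = 0 ∧ FrozenSL.der β y Real.pi = 0 ∧
    ∃ x ∈ Icc (0 : ℝ) Real.pi, y x ≠ 0

/-- `C z`, `S z` are, for every complex `z`, the solutions with the initial conditions
`C(a) = S'(a) = 1`, `S(a) = C'(a) = 0`. (For `q` in `L₂(0,π)` and `a` in `[0,π]` they exist and are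
unique on `[0,π]`.) -/
structure FrozenSL.IsFundamentalSystem (q : ℝ → ℂ) (a : ℝ) (C S : ℂ → ℝ → ℂ) : Prop where
  solution_C : ∀ z, FrozenSL.IsSolution q a z (C z)
  solution_S : ∀ z, FrozenSL.IsSolution q a z (S z)
  C_a : ∀ z, C z a = 1
  der_C_a : ∀ z, FrozenSL.der 1 (C z) a = 0
  S_a : ∀ z, S z a = 0
  der_S_a : ∀ z, FrozenSL.der 1 (S z) a = 1

/-- The characteristic function `Δ_{α,β}(z)` built from the fundamental system `C`, `S`. -/
def FrozenSL.charFun (α β : ℕ) (C S : ℂ → ℝ → ℂ) (z : ℂ) : ℂ :=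
  Matrix.det !![FrozenSL.der α (C z) 0, FrozenSL.der α (S z) 0;
    FrozenSL.der β (C z) Real.pi, FrozenSL.der β (S z) Real.pi]

/-- `(lam n)_{n ≥ 1}` is the spectrum of `L(q,a,α,β)`: its terms are exactly the eigenvalues, and
every number `z` occurs in it as many times as its multiplicity, that is, the order of `z` as a
zero of the (entire) characteristic function. -/
def FrozenSL.IsSpectrum (q : ℝ → ℂ) (a : ℝ) (α β : ℕ) (lam : ℕ+ → ℂ) : Prop :=
  range lam = {z | FrozenSL.IsEigenvalue q a α β z} ∧
  ∃ C S : ℂ → ℝ → ℂ, FrozenSL.IsFundamentalSystem q a C S ∧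
    ∀ z : ℂ, {n : ℕ+ | lam n = z}.encard = analyticOrderAt (FrozenSL.charFun α β C S) z

/-- `lam n = (n - (α+β)/2 + κ n / n)²` with `κ` in `ℓ₂`. -/
def FrozenSL.HasAsymptotics (α β : ℕ) (lam : ℕ+ → ℂ) : Prop :=
  ∃ κ : ℕ+ → ℂ, Memℓp κ 2 ∧
    ∀ n : ℕ+, lam n = ((n : ℂ) - ((α : ℂ) + (β : ℂ)) / 2 + κ n / (n : ℂ)) ^ 2

/-- The non-degenerate groups of conditions. -/
def FrozenSL.NonDegenerate (α β : ℕ) (k : ℕ+) : Prop :=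
  (α = 0 ∧ β = 1) ∨ (α = 1 ∧ β = 0 ∧ Even (k : ℕ)) ∨ (α = 1 ∧ β = 1 ∧ Odd (k : ℕ))

/-- The degenerate groups of conditions. -/
def FrozenSL.Degenerate (α β : ℕ) (k : ℕ+) : Prop :=
  (α = 0 ∧ β = 0) ∨ (α = 1 ∧ β = 0 ∧ Odd (k : ℕ)) ∨ (α = 1 ∧ β = 1 ∧ Even (k : ℕ))

/-- The degeneration condition corresponding to each degenerate group:
`lam (k n) = (k n)²`; `lam (k(n-1/2) + 1/2) = k²(n-1/2)²`; `lam (k(n-1/2) + 1) = k²(n-1/2)²`,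
for all `n ≥ 1`. In the last two the index is the positive integer `m` given by
`2m = k(2n-1) + 1`, respectively `2m = k(2n-1) + 2`. -/
def FrozenSL.DegenerationCondition (α β : ℕ) (k : ℕ+) (lam : ℕ+ → ℂ) : Prop :=
  (α = 0 ∧ β = 0 → ∀ n : ℕ+, lam (k * n) = ((k : ℂ) * (n : ℂ)) ^ 2) ∧
  (α = 1 ∧ β = 0 ∧ Odd (k : ℕ) → ∀ n m : ℕ+, 2 * (m : ℤ) = (k : ℤ) * (2 * (n : ℤ) - 1) + 1 →
    lam m = (k : ℂ) ^ 2 * ((n : ℂ) - 1 / 2) ^ 2) ∧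
  (α = 1 ∧ β = 1 ∧ Even (k : ℕ) → ∀ n m : ℕ+, 2 * (m : ℤ) = (k : ℤ) * (2 * (n : ℤ) - 1) + 2 →
    lam m = (k : ℂ) ^ 2 * ((n : ℂ) - 1 / 2) ^ 2)

end

namespace FrozenSL
noncomputable section

/-! Let `μ m = freq α β m ^ 2` and `eig m` be the eigenvalues and eigenfunctions of the unperturbed
problem `-y'' = z y`, and look for `q` as a series `∑ b m * eig m`. Then `E = ∑ b m * eig m / (μ m -
z)` satisfies `-E'' - z E = q` and both boundary conditions. Because the argument is frozen, `(1 + E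
a) cos(√z (x - a)) - E x` is a solution with value `1` at `a`, and the characteristic function
factors exactly (`charFun_eq_mul`): it is the unperturbed one times `1 + ∑ b m * eig m a / (μ m -
z)`. The dependence on the unknown coefficients is affine.

The prescribed spectrum requires this second factor to be `∏ (lam n - z) / (μ n - z)`. With `d n =
lam n - μ n`, the product has a partial fraction expansion `1 + ∑ c m / (μ m - z)`, where `c m = d m
* ∏_{n ≠ m} (1 + d n / (μ n - μ m))` (`tprod_eq_one_add_tsum`). The asymptotics put `d` in `ℓ₂`
(`summable_deviation`), and the products are bounded uniformly in `m` (`exists_tsum_le`), so `c` is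
in `ℓ₂` too. The inverse problem thus becomes the scalar equations `b m * eig m a = c m` with `b` in
`ℓ₂`. Conversely, a factorization of this kind determines the zeros with multiplicities
(`analyticAt_and_order_of_eq_mul_tprod`).

At `a = π / k` the values `eig m a` are periodic in `m`, so the nonzero ones are bounded away from
zero. In the non-degenerate case none vanishes. In the degenerate case the degeneration condition
says `d m = 0`, hence `c m = 0`, wherever `eig m a = 0`; there `b m` is arbitrary, which gives
non-uniqueness. -/

lemma sqrt_sq (u : ℂ) : (u ^ (1 / 2 : ℂ)) ^ 2 = u := by
  rw [← Complex.cpow_nat_mul]; simp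

lemma exists_sq_eq (u : ℂ) : ∃ w : ℂ, w ^ 2 = u := ⟨_, sqrt_sq u⟩

/-! ### Entire functions of the square root -/

/-- An even entire function is an entire function of the square. -/
lemma differentiable_comp_sqrt {f : ℂ → ℂ} (hf : Differentiable ℂ f) (he : ∀ w, f (-w) = f w) :
    Differentiable ℂ (fun u : ℂ => f (u ^ (1 / 2 : ℂ))) := by
  have hsq : ∀ u w : ℂ, w ^ 2 = u → f (u ^ (1 / 2 : ℂ)) = f w := by
    intro u w h
    have h2 : (u ^ (1 / 2 : ℂ)) ^ 2 = w ^ 2 := by rw [sqrt_sq, h]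
    rcases sq_eq_sq_iff_eq_or_eq_neg.1 h2 with h | h <;> simp only [h, he]
  have hs : ∀ u ∈ Complex.slitPlane, DifferentiableAt ℂ (fun u : ℂ => f (u ^ (1 / 2 : ℂ))) u := by
    intro u hu
    exact (hf _).comp u ((differentiableAt_id).cpow_const hu)
  have hne : ∀ u : ℂ, u ≠ 0 → DifferentiableAt ℂ (fun u : ℂ => f (u ^ (1 / 2 : ℂ))) u := by
    intro u hu
    by_cases h : u ∈ Complex.slitPlane
    · exact hs u h
    · have hu' : -u ∈ Complex.slitPlane :=
        (Complex.mem_slitPlane_or_neg_mem_slitPlane hu).resolve_left h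
      -- On the cut, `I * √(-u)` is another square root of `u`, holomorphic near the point; evenness
      -- makes `f` blind to the choice of root.
      have : (fun u : ℂ => f (u ^ (1 / 2 : ℂ)))
          = fun u : ℂ => f (Complex.I * (-u) ^ (1 / 2 : ℂ)) := by
        ext v
        apply hsq
        rw [mul_pow, sqrt_sq]; simp
      rw [this]
      exact (hf _).comp u (((differentiableAt_id.neg).cpow_const hu').const_mul _)
  intro u
  by_cases h : u = 0
  · subst h
    apply AnalyticAt.differentiableAt
    apply Complex.analyticAt_of_differentiable_on_punctured_nhds_of_continuousAt
    · filter_upwards [self_mem_nhdsWithin] with v hv using hne v hv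
    · apply ContinuousAt.comp (g := f)
      · exact hf.continuous.continuousAt
      · exact (Complex.continuousAt_cpow_const_of_re_pos (by simp) (by norm_num))
  · exact hne u h

/-- The entire function with `cosSqrt (w ^ 2) = cos w`. -/
def cosSqrt (u : ℂ) : ℂ := Complex.cos (u ^ (1 / 2 : ℂ))

lemma differentiable_cosSqrt : Differentiable ℂ cosSqrt :=
  differentiable_comp_sqrt Complex.differentiable_cos Complex.cos_neg

lemma cosSqrt_sq (w : ℂ) : cosSqrt (w ^ 2) = Complex.cos w := by
  have h2 : ((w ^ 2) ^ (1 / 2 : ℂ)) ^ 2 = w ^ 2 := sqrt_sq _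
  unfold cosSqrt
  rcases sq_eq_sq_iff_eq_or_eq_neg.1 h2 with h | h <;> rw [h]
  exact Complex.cos_neg w

/-- The entire function with `w * sincSqrt (w ^ 2) = sin w`. -/
def sincSqrt (u : ℂ) : ℂ := -2 * deriv cosSqrt u

/-- Defining `sincSqrt` through a derivative avoids the removable singularity of `sin w / w`; the
relation with the sine is recovered in `mul_sincSqrt_sq` by differentiating `cosSqrt (w ^ 2) = cos
w`. -/
lemma differentiable_sincSqrt : Differentiable ℂ sincSqrt := by
  have := differentiable_cosSqrt.contDiff (n := 2)
  exact (this.differentiable_deriv_two).const_mul _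

lemma hasDerivAt_cosSqrt (u : ℂ) : HasDerivAt cosSqrt (-(sincSqrt u) / 2) u := by
  have := (differentiable_cosSqrt u).hasDerivAt
  exact this.congr_deriv (by unfold sincSqrt; ring)

lemma mul_sincSqrt_sq (w : ℂ) : w * sincSqrt (w ^ 2) = Complex.sin w := by
  have h1 : HasDerivAt (fun w : ℂ => cosSqrt (w ^ 2)) (-(sincSqrt (w ^ 2)) / 2 * (2 * w)) w := by
    have := (hasDerivAt_cosSqrt (w ^ 2)).comp w (hasDerivAt_pow 2 w)
    exact this.congr_deriv (by simp)
  have h2 : HasDerivAt (fun w : ℂ => cosSqrt (w ^ 2)) (-Complex.sin w) w := by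
    simp only [cosSqrt_sq]; exact Complex.hasDerivAt_cos w
  have := h1.unique h2
  linear_combination -this

/-- This is the derivative of `w * sincSqrt (w ^ 2) = sin w`, written in `u = w ^ 2`. -/
lemma sincSqrt_add (u : ℂ) : sincSqrt u + 2 * u * deriv sincSqrt u = cosSqrt u := by
  obtain ⟨w, rfl⟩ := exists_sq_eq u
  have h0 := (differentiable_sincSqrt (w ^ 2)).hasDerivAt
  have h1 : HasDerivAt (fun w : ℂ => w * sincSqrt (w ^ 2))
      (1 * sincSqrt (w ^ 2) + w * (deriv sincSqrt (w ^ 2) * (2 * w))) w := by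
    have := (hasDerivAt_id w).mul (h0.comp w (hasDerivAt_pow 2 w))
    exact this.congr_deriv (by simp)
  have h2 : HasDerivAt (fun w : ℂ => w * sincSqrt (w ^ 2)) (Complex.cos w) w := by
    simp only [mul_sincSqrt_sq]; exact Complex.hasDerivAt_sin w
  have := h1.unique h2
  rw [cosSqrt_sq]
  linear_combination this

lemma sincSqrt_zero : sincSqrt 0 = 1 := by
  have := sincSqrt_add 0
  have h : cosSqrt 0 = 1 := by simpa using cosSqrt_sq 0
  simpa [h] using this

lemma cosSqrt_zero : cosSqrt 0 = 1 := by simpa using cosSqrt_sq 0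

lemma cosSqrt_sq_add (u : ℂ) : cosSqrt u ^ 2 + u * sincSqrt u ^ 2 = 1 := by
  obtain ⟨w, rfl⟩ := exists_sq_eq u
  have := mul_sincSqrt_sq w
  rw [← mul_pow, this, cosSqrt_sq]
  exact Complex.cos_sq_add_sin_sq w

lemma cosSqrt_eq_zero_iff (u : ℂ) :
    cosSqrt u = 0 ↔ ∃ n : ℕ+, u = (((n : ℂ) - 1 / 2) * Real.pi) ^ 2 := by
  obtain ⟨w, rfl⟩ := exists_sq_eq u
  rw [cosSqrt_sq, Complex.cos_eq_zero_iff]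
  constructor
  · rintro ⟨j, rfl⟩
    -- The zeros `(j + 1/2)π` pair up as `±(n - 1/2)π`, and squaring identifies the pair: `n = j +
    -- 1` for `j ≥ 0`, `n = -j` otherwise.
    rcases le_or_gt 0 j with hj | hj
    · lift j to ℕ using hj
      refine ⟨⟨j + 1, by omega⟩, ?_⟩
      push_cast [PNat.mk_coe]; ring
    · obtain ⟨i, rfl⟩ : ∃ i : ℕ, j = -(i : ℤ) - 1 := ⟨(-j - 1).toNat, by omega⟩
      refine ⟨⟨i + 1, by omega⟩, ?_⟩
      push_cast [PNat.mk_coe]; ring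
  · rintro ⟨n, hn⟩
    rcases sq_eq_sq_iff_eq_or_eq_neg.1 hn with h | h
    · exact ⟨(n : ℤ) - 1, by rw [h]; push_cast; ring⟩
    · exact ⟨-(n : ℤ), by rw [h]; push_cast; ring⟩

lemma sincSqrt_eq_zero_iff (u : ℂ) :
    sincSqrt u = 0 ↔ ∃ n : ℕ+, u = ((n : ℂ) * Real.pi) ^ 2 := by
  obtain ⟨w, rfl⟩ := exists_sq_eq u
  by_cases hw : w = 0
  · subst hw
    have h2 : ∀ n : ℕ+, ((n : ℂ) * Real.pi) ^ 2 ≠ 0 := fun n => by simp [Real.pi_ne_zero]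
    simp only [ne_eq, OfNat.ofNat_ne_zero, not_false_eq_true, zero_pow, sincSqrt_zero, one_ne_zero,
      false_iff, not_exists]
    exact fun n => (h2 n).symm
  have hz : sincSqrt (w ^ 2) = 0 ↔ Complex.sin w = 0 := by
    rw [← mul_sincSqrt_sq]; simp [hw]
  rw [hz, Complex.sin_eq_zero_iff]
  constructor
  · rintro ⟨j, rfl⟩
    have hj : j ≠ 0 := by rintro rfl; simp at hw
    refine ⟨⟨j.natAbs, by omega⟩, ?_⟩
    have : ((j.natAbs : ℕ) : ℂ) ^ 2 = (j : ℂ) ^ 2 := by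
      obtain ⟨i, rfl | rfl⟩ := j.eq_nat_or_neg <;> simp
    simp only [PNat.mk_coe, mul_pow, this]
  · rintro ⟨n, hn⟩
    rcases sq_eq_sq_iff_eq_or_eq_neg.1 hn with h | h
    · exact ⟨n, by rw [h]; push_cast; ring⟩
    · exact ⟨-n, by rw [h]; push_cast; ring⟩

/-- Simplicity of the zeros: at a zero, `2 * u * deriv sincSqrt u = cosSqrt u`, and the two
functions cannot vanish together by the Pythagorean identity. -/
lemma deriv_sincSqrt_ne_zero {u : ℂ} (h : sincSqrt u = 0) : u * deriv sincSqrt u ≠ 0 := by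
  intro h0
  have h1 := sincSqrt_add u
  have h2 := cosSqrt_sq_add u
  have h3 : cosSqrt u = 0 := by rw [← h1, h]; linear_combination 2 * h0
  simp [h, h3] at h2

/-- The solution `cos (√z x)` of `y'' = -z y`. -/
def cosSol (z : ℂ) (x : ℝ) : ℂ := cosSqrt (z * (x : ℂ) ^ 2)

/-- The solution `sin (√z x) / √z` of `y'' = -z y`. -/
def sinSol (z : ℂ) (x : ℝ) : ℂ := x * sincSqrt (z * (x : ℂ) ^ 2)

lemma cosSol_sq (w : ℂ) (x : ℝ) : cosSol (w ^ 2) x = Complex.cos (w * x) := by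
  rw [cosSol, ← mul_pow, cosSqrt_sq]

lemma mul_sinSol_sq (w : ℂ) (x : ℝ) : w * sinSol (w ^ 2) x = Complex.sin (w * x) := by
  rw [sinSol, ← mul_pow, ← mul_assoc, mul_sincSqrt_sq]

@[simp] lemma cosSol_zero (z : ℂ) : cosSol z 0 = 1 := by simp [cosSol, cosSqrt_zero]
@[simp] lemma sinSol_zero (z : ℂ) : sinSol z 0 = 0 := by simp [sinSol]
lemma cosSol_neg (z : ℂ) (x : ℝ) : cosSol z (-x) = cosSol z x := by simp [cosSol]
lemma sinSol_neg (z : ℂ) (x : ℝ) : sinSol z (-x) = -sinSol z x := by simp [sinSol]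

lemma cosSol_sq_add (z : ℂ) (x : ℝ) : cosSol z x ^ 2 + z * sinSol z x ^ 2 = 1 := by
  have := cosSqrt_sq_add (z * (x : ℂ) ^ 2)
  unfold cosSol sinSol
  linear_combination this

lemma hasDerivAt_cosSol (z : ℂ) (x : ℝ) : HasDerivAt (cosSol z) (-z * sinSol z x) x := by
  have h : HasDerivAt (fun v : ℂ => cosSqrt (z * v ^ 2))
      (-(sincSqrt (z * (x : ℂ) ^ 2)) / 2 * (z * (2 * x))) (x : ℂ) := by
    have := (hasDerivAt_cosSqrt (z * (x : ℂ) ^ 2)).comp (x : ℂ)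
      ((hasDerivAt_pow 2 (x : ℂ)).const_mul z)
    exact this.congr_deriv (by simp)
  exact h.comp_ofReal.congr_deriv (by unfold sinSol; ring)

lemma hasDerivAt_sinSol (z : ℂ) (x : ℝ) : HasDerivAt (sinSol z) (cosSol z x) x := by
  have h0 := (differentiable_sincSqrt (z * (x : ℂ) ^ 2)).hasDerivAt
  have h : HasDerivAt (fun v : ℂ => v * sincSqrt (z * v ^ 2))
      (1 * sincSqrt (z * (x : ℂ) ^ 2) +
        x * (deriv sincSqrt (z * (x : ℂ) ^ 2) * (z * (2 * x)))) (x : ℂ) := by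
    have := (hasDerivAt_id (x : ℂ)).mul (h0.comp (x : ℂ) ((hasDerivAt_pow 2 (x : ℂ)).const_mul z))
    exact this.congr_deriv (by simp)
  exact h.comp_ofReal.congr_deriv (by rw [cosSol, ← sincSqrt_add]; ring)

lemma continuous_cosSol : Continuous (fun p : ℂ × ℝ => cosSol p.1 p.2) := by
  unfold cosSol
  exact differentiable_cosSqrt.continuous.comp (by fun_prop)

lemma continuous_sinSol : Continuous (fun p : ℂ × ℝ => sinSol p.1 p.2) := by
  unfold sinSol
  exact (by fun_prop : Continuous fun p : ℂ × ℝ => (p.2 : ℂ)).mul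
    (differentiable_sincSqrt.continuous.comp (by fun_prop))

lemma cosSol_add (z : ℂ) (x y : ℝ) :
    cosSol z (x + y) = cosSol z x * cosSol z y - z * sinSol z x * sinSol z y := by
  obtain ⟨w, rfl⟩ := exists_sq_eq z
  have h1 := mul_sinSol_sq w x
  have h2 := mul_sinSol_sq w y
  have : w ^ 2 * sinSol (w ^ 2) x * sinSol (w ^ 2) y = Complex.sin (w * x) * Complex.sin (w * y) := by
    rw [← h1, ← h2]; ring
  rw [this, cosSol_sq, cosSol_sq, cosSol_sq, ← Complex.cos_add]
  push_cast; ring_nf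

lemma sinSol_add (z : ℂ) (x y : ℝ) :
    sinSol z (x + y) = sinSol z x * cosSol z y + cosSol z x * sinSol z y := by
  obtain ⟨w, rfl⟩ := exists_sq_eq z
  by_cases hw : w = 0
  · subst hw; simp [cosSol, sinSol, cosSqrt_zero, sincSqrt_zero]
  apply mul_left_cancel₀ hw
  rw [mul_add, mul_left_comm w (cosSol _ _), ← mul_assoc w]
  rw [mul_sinSol_sq, mul_sinSol_sq, mul_sinSol_sq, cosSol_sq, cosSol_sq, ← Complex.sin_add]
  push_cast; ring_nf

/-! ### Solutions of the frozen equation: linearity, uniqueness, the characteristic determinant. -/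

lemma uniqueDiffOn_segment : UniqueDiffOn ℝ (Icc 0 Real.pi) := uniqueDiffOn_Icc Real.pi_pos

@[simp] lemma der_zero (y : ℝ → ℂ) (x : ℝ) : der 0 y x = y x := by
  simp [der, iteratedDerivWithin_zero]

lemma der_one (y : ℝ → ℂ) (x : ℝ) : der 1 y x = derivWithin y (Icc 0 Real.pi) x := by
  simp [der, iteratedDerivWithin_one]

lemma der_one_eq {y : ℝ → ℂ} {y' : ℂ} {x : ℝ} (hx : x ∈ Icc 0 Real.pi)
    (h : HasDerivWithinAt y y' (Icc 0 Real.pi) x) : der 1 y x = y' := by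
  rw [der_one]; exact h.derivWithin (uniqueDiffOn_segment x hx)

lemma zero_mem_segment : (0 : ℝ) ∈ Icc 0 Real.pi := ⟨le_rfl, Real.pi_pos.le⟩
lemma pi_mem_segment : Real.pi ∈ Icc 0 Real.pi := ⟨Real.pi_pos.le, le_rfl⟩

lemma der_congr {m : ℕ} {y₁ y₂ : ℝ → ℂ} (h : ∀ x ∈ Icc 0 Real.pi, y₁ x = y₂ x) {x : ℝ}
    (hx : x ∈ Icc 0 Real.pi) : der m y₁ x = der m y₂ x := by
  unfold der
  exact iteratedDerivWithin_congr h hx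

lemma isSolution_of_hasDerivWithinAt {q : ℝ → ℂ} {a : ℝ} {z : ℂ} {y g : ℝ → ℂ}
    (h : ∀ x ∈ Icc 0 Real.pi, HasDerivWithinAt y (g x) (Icc 0 Real.pi) x)
    (hg : ∀ x ∈ Icc 0 Real.pi, g x = g 0 + ∫ t in (0 : ℝ)..x, (q t * y a - z * y t)) :
    IsSolution q a z y where
  differentiableOn x hx := (h x hx).differentiableWithinAt
  der_eq x hx := by
    rw [der_one_eq hx (h x hx), der_one_eq zero_mem_segment (h 0 zero_mem_segment), hg x hx]

lemma IsSolution.hasDerivWithinAt {q : ℝ → ℂ} {a : ℝ} {z : ℂ} {y : ℝ → ℂ}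
    (h : IsSolution q a z y) {x : ℝ} (hx : x ∈ Icc 0 Real.pi) :
    HasDerivWithinAt y (der 1 y x) (Icc 0 Real.pi) x := by
  rw [der_one]
  exact (h.differentiableOn x hx).hasDerivWithinAt

lemma IsSolution.intervalIntegrable {q : ℝ → ℂ} {a : ℝ} {z : ℂ} {y : ℝ → ℂ}
    (h : IsSolution q a z y) {x : ℝ} (hx : x ∈ Icc 0 Real.pi) :
    IntervalIntegrable y volume 0 x := by
  apply ContinuousOn.intervalIntegrable
  rw [uIcc_of_le hx.1]
  exact h.differentiableOn.continuousOn.mono (Icc_subset_Icc le_rfl hx.2)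

lemma der_comb {m : ℕ} (hm : m = 0 ∨ m = 1) {q : ℝ → ℂ} {a : ℝ} {z : ℂ} {y₁ y₂ : ℝ → ℂ}
    (h₁ : IsSolution q a z y₁) (h₂ : IsSolution q a z y₂) (r s : ℂ) {x : ℝ}
    (hx : x ∈ Icc 0 Real.pi) :
    der m (fun t => r * y₁ t + s * y₂ t) x = r * der m y₁ x + s * der m y₂ x := by
  rcases hm with rfl | rfl
  · simp
  · exact der_one_eq hx
      (((h₁.hasDerivWithinAt hx).const_mul r).add ((h₂.hasDerivWithinAt hx).const_mul s))

lemma IsSolution.comb {q : ℝ → ℂ} (hq : Integrable q) {a : ℝ} {z : ℂ} {y₁ y₂ : ℝ → ℂ}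
    (h₁ : IsSolution q a z y₁) (h₂ : IsSolution q a z y₂) (r s : ℂ) :
    IsSolution q a z (fun t => r * y₁ t + s * y₂ t) := by
  apply isSolution_of_hasDerivWithinAt (g := fun x => r * der 1 y₁ x + s * der 1 y₂ x)
  · intro x hx
    exact ((h₁.hasDerivWithinAt hx).const_mul r).add ((h₂.hasDerivWithinAt hx).const_mul s)
  · intro x hx
    have e1 := h₁.der_eq x hx
    have e2 := h₂.der_eq x hx
    have i1 : IntervalIntegrable (fun t => q t * y₁ a - z * y₁ t) volume 0 x :=
      (hq.intervalIntegrable.mul_const _).sub ((h₁.intervalIntegrable hx).const_mul z)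
    have i2 : IntervalIntegrable (fun t => q t * y₂ a - z * y₂ t) volume 0 x :=
      (hq.intervalIntegrable.mul_const _).sub ((h₂.intervalIntegrable hx).const_mul z)
    have : (∫ t in (0 : ℝ)..x, (q t * (r * y₁ a + s * y₂ a) - z * (r * y₁ t + s * y₂ t)))
        = r * (∫ t in (0 : ℝ)..x, (q t * y₁ a - z * y₁ t))
          + s * ∫ t in (0 : ℝ)..x, (q t * y₂ a - z * y₂ t) := by
      rw [← intervalIntegral.integral_const_mul, ← intervalIntegral.integral_const_mul,
        ← intervalIntegral.integral_add (i1.const_mul r) (i2.const_mul s)]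
      congr 1; ext t; ring
    rw [this, e1, e2]; ring

lemma constant_on_segment {f : ℝ → ℂ}
    (h : ∀ x ∈ Icc 0 Real.pi, HasDerivWithinAt f 0 (Icc 0 Real.pi) x) {x y : ℝ}
    (hx : x ∈ Icc 0 Real.pi) (hy : y ∈ Icc 0 Real.pi) : f x = f y :=
  (convex_Icc 0 Real.pi).is_const_of_fderivWithin_eq_zero (𝕜 := ℝ)
    (fun t ht => (h t ht).differentiableWithinAt)
    (fun t ht => by
      have := (h t ht).hasFDerivWithinAt.fderivWithin (uniqueDiffOn_segment t ht)
      rw [this]; ext; simp) hx hy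

/-- When `y a = 0` the term with `q` disappears and `y'' = -z y`. With `c`, `s` the free solutions
centred at `a`, both `y c - y' s` and `z y s + y' c` are constant, hence zero; `c² + z s² = 1` then
isolates `y`. -/
lemma IsSolution.eq_zero {q : ℝ → ℂ} {a : ℝ} (ha : a ∈ Icc 0 Real.pi) {z : ℂ} {y : ℝ → ℂ}
    (h : IsSolution q a z y) (h0 : y a = 0) (h1 : der 1 y a = 0) {x : ℝ}
    (hx : x ∈ Icc 0 Real.pi) : y x = 0 := by
  set c : ℝ → ℂ := fun x => cosSol z (x - a) with hc
  set s : ℝ → ℂ := fun x => sinSol z (x - a) with hs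
  have hc' : ∀ x, HasDerivWithinAt c (-z * s x) (Icc 0 Real.pi) x := fun x =>
    ((hasDerivAt_cosSol z (x - a)).comp_sub_const x a).hasDerivWithinAt
  have hs' : ∀ x, HasDerivWithinAt s (c x) (Icc 0 Real.pi) x := fun x =>
    ((hasDerivAt_sinSol z (x - a)).comp_sub_const x a).hasDerivWithinAt
  have hy : ∀ x ∈ Icc 0 Real.pi, HasDerivWithinAt y (der 1 y x) (Icc 0 Real.pi) x :=
    fun x hx => h.hasDerivWithinAt hx
  have hg : ∀ x ∈ Icc 0 Real.pi,
      HasDerivWithinAt (der 1 y) (-z * y x) (Icc 0 Real.pi) x := by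
    -- A continuous extension of `y` to the line lets the fundamental theorem of calculus apply at
    -- the end points as well.
    set w : ℝ → ℂ := IccExtend Real.pi_pos.le ((Icc 0 Real.pi).domRestrict y) with hw
    have hwc : Continuous w :=
      (continuousOn_iff_continuous_domRestrict.1 h.differentiableOn.continuousOn).Icc_extend'
    have hwy : ∀ t ∈ Icc 0 Real.pi, w t = y t := fun t ht => by
      rw [hw, IccExtend_of_mem _ _ ht]; rfl
    intro x hx
    have e : ∀ t ∈ Icc 0 Real.pi,
        der 1 y t = der 1 y 0 + (-z) * ∫ t in (0 : ℝ)..t, w t := by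
      intro t ht
      rw [h.der_eq t ht, h0, ← intervalIntegral.integral_const_mul]
      congr 1
      apply intervalIntegral.integral_congr
      intro u hu
      rw [uIcc_of_le ht.1] at hu
      beta_reduce
      rw [hwy u ⟨hu.1, hu.2.trans ht.2⟩]; ring
    rw [← hwy x hx]
    exact ((((hwc.integral_hasStrictDerivAt 0 x).hasDerivAt.const_mul (-z)).const_add
      (der 1 y 0)).hasDerivWithinAt).congr e (e x hx)
  have hp : ∀ x ∈ Icc 0 Real.pi, y x * c x - der 1 y x * s x = 0 := by
    intro x hx
    have := constant_on_segment (f := fun x => y x * c x - der 1 y x * s x) (fun t ht =>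
      (((hy t ht).mul (hc' t)).sub ((hg t ht).mul (hs' t))).congr_deriv (by ring)) hx ha
    simpa [h0, h1] using this
  have hr : ∀ x ∈ Icc 0 Real.pi, z * (y x * s x) + der 1 y x * c x = 0 := by
    intro x hx
    have := constant_on_segment (f := fun x => z * (y x * s x) + der 1 y x * c x) (fun t ht =>
      ((((hy t ht).mul (hs' t)).const_mul z).add ((hg t ht).mul (hc' t))).congr_deriv (by ring))
      hx ha
    simpa [h0, h1] using this
  have e := cosSol_sq_add z (x - a)
  have e1 := hp x hx
  have e2 := hr x hx
  simp only [hc, hs] at e1 e2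
  linear_combination (-y x) * e + cosSol z (x - a) * e1 + sinSol z (x - a) * e2

/-- Every solution is a combination of the fundamental system. -/
lemma IsSolution.eq_comb {q : ℝ → ℂ} (hq : Integrable q) {a : ℝ} (ha : a ∈ Icc 0 Real.pi)
    {z : ℂ} {C S : ℂ → ℝ → ℂ} (hCS : IsFundamentalSystem q a C S) {y : ℝ → ℂ}
    (h : IsSolution q a z y) {x : ℝ} (hx : x ∈ Icc 0 Real.pi) :
    y x = y a * C z x + der 1 y a * S z x := by
  have h1 := (hCS.solution_C z).comb hq (hCS.solution_S z) (y a) (der 1 y a)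
  have h2 := h.comb hq h1 1 (-1)
  have := h2.eq_zero ha (by simp [hCS.C_a, hCS.S_a])
    (by rw [der_comb (.inr rfl) h h1 _ _ ha,
          der_comb (.inr rfl) (hCS.solution_C z) (hCS.solution_S z) _ _ ha]
        simp [hCS.der_C_a, hCS.der_S_a]) hx
  linear_combination this

lemma IsSolution.der_eq_comb {m : ℕ} (hm : m = 0 ∨ m = 1) {q : ℝ → ℂ} (hq : Integrable q)
    {a : ℝ} (ha : a ∈ Icc 0 Real.pi)
    {z : ℂ} {C S : ℂ → ℝ → ℂ} (hCS : IsFundamentalSystem q a C S) {y : ℝ → ℂ}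
    (h : IsSolution q a z y) {x : ℝ} (hx : x ∈ Icc 0 Real.pi) :
    der m y x = y a * der m (C z) x + der 1 y a * der m (S z) x := by
  rw [der_congr (fun t ht => h.eq_comb hq ha hCS ht) hx,
    der_comb hm (hCS.solution_C z) (hCS.solution_S z) _ _ hx]

lemma charFun_eq (α β : ℕ) (C S : ℂ → ℝ → ℂ) (z : ℂ) :
    charFun α β C S z = der α (C z) 0 * der β (S z) Real.pi
      - der α (S z) 0 * der β (C z) Real.pi := by
  rw [charFun, Matrix.det_fin_two_of]

/-- The boundary conditions are a homogeneous linear system for `(y a, y' a)`, whose determinant is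
the characteristic function. -/
lemma isEigenvalue_iff {α β : ℕ} (hα : α = 0 ∨ α = 1) (hβ : β = 0 ∨ β = 1) {q : ℝ → ℂ}
    (hq : Integrable q) {a : ℝ} (ha : a ∈ Icc 0 Real.pi)
    {C S : ℂ → ℝ → ℂ} (hCS : IsFundamentalSystem q a C S) (z : ℂ) :
    IsEigenvalue q a α β z ↔ charFun α β C S z = 0 := by
  rw [charFun, ← Matrix.exists_mulVec_eq_zero_iff]
  constructor
  · rintro ⟨y, hy, h0, hpi, x, hx, hne⟩
    refine ⟨![y a, der 1 y a], ?_, ?_⟩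
    · intro h
      have e0 : y a = 0 := congrFun h 0
      have e1 : der 1 y a = 0 := congrFun h 1
      exact hne (hy.eq_zero ha e0 e1 hx)
    · rw [hy.der_eq_comb hα hq ha hCS zero_mem_segment] at h0
      rw [hy.der_eq_comb hβ hq ha hCS pi_mem_segment] at hpi
      ext i; fin_cases i
      · simpa [Matrix.mulVec, dotProduct, mul_comm] using h0
      · simpa [Matrix.mulVec, dotProduct, mul_comm] using hpi
  · rintro ⟨v, hv, h⟩
    have h1 := hCS.solution_C z
    have h2 := hCS.solution_S z
    have hs := h1.comb hq h2 (v 0) (v 1)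
    refine ⟨_, hs, ?_, ?_, ?_⟩
    · rw [der_comb hα h1 h2 _ _ zero_mem_segment]
      simpa [Matrix.mulVec, dotProduct, mul_comm] using congrFun h 0
    · rw [der_comb hβ h1 h2 _ _ pi_mem_segment]
      simpa [Matrix.mulVec, dotProduct, mul_comm] using congrFun h 1
    · by_contra! hcon
      apply hv
      have e0 : v 0 = 0 := by simpa [hCS.C_a, hCS.S_a] using hcon a ha
      have e1 : v 1 = 0 := by
        have hd := der_comb (.inr rfl) h1 h2 (v 0) (v 1) ha
        rw [der_congr (y₂ := fun _ => 0) hcon ha,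
          der_one_eq ha (hasDerivWithinAt_const _ _ _)] at hd
        simpa [hCS.der_C_a, hCS.der_S_a] using hd.symm
      ext i; fin_cases i <;> assumption

/-- The characteristic function can be computed from any solution equal to `1` at `a`. -/
lemma charFun_eq_of_isSolution {α β : ℕ} (hα : α = 0 ∨ α = 1) (hβ : β = 0 ∨ β = 1) {q : ℝ → ℂ}
    (hq : Integrable q) {a : ℝ} (ha : a ∈ Icc 0 Real.pi)
    {C S : ℂ → ℝ → ℂ} (hCS : IsFundamentalSystem q a C S) {z : ℂ} {y : ℝ → ℂ}
    (hy : IsSolution q a z y) (hya : y a = 1) :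
    charFun α β C S z = der α y 0 * der β (S z) Real.pi - der α (S z) 0 * der β y Real.pi := by
  rw [charFun_eq, hy.der_eq_comb hα hq ha hCS zero_mem_segment,
    hy.der_eq_comb hβ hq ha hCS pi_mem_segment, hya]
  ring

/-! ### The explicit fundamental system -/

/-- The antiderivative of `q` vanishing at `a`. -/
def primitive (q : ℝ → ℂ) (a x : ℝ) : ℂ := ∫ t in a..x, q t

lemma continuous_primitive {q : ℝ → ℂ} (hq : Integrable q) (a : ℝ) :
    Continuous (primitive q a) :=
  intervalIntegral.continuous_primitive (fun _ _ => hq.intervalIntegrable) a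

/-- `∫_a^x cos(√z t) Q(t) dt`, where `Q` is the antiderivative of `q`. -/
def cosMoment (q : ℝ → ℂ) (a : ℝ) (z : ℂ) (x : ℝ) : ℂ :=
  ∫ t in a..x, cosSol z t * primitive q a t

/-- `∫_a^x sin(√z t)/√z Q(t) dt`, where `Q` is the antiderivative of `q`. -/
def sinMoment (q : ℝ → ℂ) (a : ℝ) (z : ℂ) (x : ℝ) : ℂ :=
  ∫ t in a..x, sinSol z t * primitive q a t

/-- `∫_a^x cos(√z (x - t)) Q(t) dt`. -/
def duhamelCos (q : ℝ → ℂ) (a : ℝ) (z : ℂ) (x : ℝ) : ℂ :=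
  cosSol z x * cosMoment q a z x + z * (sinSol z x * sinMoment q a z x)

/-- `∫_a^x sin(√z (x - t))/√z Q(t) dt`. -/
def duhamelSin (q : ℝ → ℂ) (a : ℝ) (z : ℂ) (x : ℝ) : ℂ :=
  sinSol z x * cosMoment q a z x - cosSol z x * sinMoment q a z x

/-- The first fundamental solution. -/
def solC (q : ℝ → ℂ) (a : ℝ) (z : ℂ) (x : ℝ) : ℂ := cosSol z (x - a) + duhamelCos q a z x

/-- The derivative of the first fundamental solution. -/
def solC' (q : ℝ → ℂ) (a : ℝ) (z : ℂ) (x : ℝ) : ℂ :=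
  -z * sinSol z (x - a) + (primitive q a x - z * duhamelSin q a z x)

/-- The second fundamental solution. -/
def solS (a : ℝ) (z : ℂ) (x : ℝ) : ℂ := sinSol z (x - a)

section
variable {q : ℝ → ℂ} (hq : Integrable q) (a : ℝ) (z : ℂ) (x : ℝ)
include hq

lemma hasDerivAt_cosMoment :
    HasDerivAt (cosMoment q a z) (cosSol z x * primitive q a x) x := by
  have : Continuous fun t => cosSol z t * primitive q a t :=
    (continuous_cosSol.comp (Continuous.prodMk_right z)).mul (continuous_primitive hq a)
  exact (this.integral_hasStrictDerivAt a x).hasDerivAt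

lemma hasDerivAt_sinMoment :
    HasDerivAt (sinMoment q a z) (sinSol z x * primitive q a x) x := by
  have : Continuous fun t => sinSol z t * primitive q a t :=
    (continuous_sinSol.comp (Continuous.prodMk_right z)).mul (continuous_primitive hq a)
  exact (this.integral_hasStrictDerivAt a x).hasDerivAt

/-- Variation of constants gives the integral of `sin(√z (x - t))/√z` against `q`; integration by
parts turns it into `duhamelCos`, which involves only the continuous antiderivative of `q`. All
derivatives are therefore classical and hold everywhere. -/
lemma hasDerivAt_duhamelCos :
    HasDerivAt (duhamelCos q a z) (primitive q a x - z * duhamelSin q a z x) x := by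
  have h := ((hasDerivAt_cosSol z x).mul (hasDerivAt_cosMoment hq a z x)).add
    (((hasDerivAt_sinSol z x).mul (hasDerivAt_sinMoment hq a z x)).const_mul z)
  refine h.congr_deriv ?_
  unfold duhamelSin
  linear_combination (primitive q a x) * cosSol_sq_add z x

lemma hasDerivAt_duhamelSin :
    HasDerivAt (duhamelSin q a z) (duhamelCos q a z x) x := by
  have h := ((hasDerivAt_sinSol z x).mul (hasDerivAt_cosMoment hq a z x)).sub
    ((hasDerivAt_cosSol z x).mul (hasDerivAt_sinMoment hq a z x))
  refine h.congr_deriv ?_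
  unfold duhamelCos
  ring

lemma hasDerivAt_solC : HasDerivAt (solC q a z) (solC' q a z x) x :=
  ((hasDerivAt_cosSol z (x - a)).comp_sub_const x a).add (hasDerivAt_duhamelCos hq a z x)

lemma isSolution_solC : IsSolution q a z (solC q a z) := by
  apply isSolution_of_hasDerivWithinAt (g := solC' q a z)
  · intro x _
    exact (hasDerivAt_solC hq a z x).hasDerivWithinAt
  · intro x _
    have hC : Continuous (solC q a z) :=
      continuous_iff_continuousAt.2 fun t => (hasDerivAt_solC hq a z t).continuousAt
    have ha : solC q a z a = 1 := by
      simp [solC, duhamelCos, cosMoment, sinMoment]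
    rw [ha, intervalIntegral.integral_sub (hq.intervalIntegrable.mul_const _)
      ((hC.const_mul z).intervalIntegrable _ _)]
    have h1 : (∫ t in (0 : ℝ)..x, q t * 1) = primitive q a x - primitive q a 0 := by
      simp only [mul_one, primitive]
      rw [intervalIntegral.integral_interval_sub_left hq.intervalIntegrable hq.intervalIntegrable]
    have h2 : (∫ t in (0 : ℝ)..x, z * solC q a z t)
        = z * (sinSol z (x - a) + duhamelSin q a z x)
          - z * (sinSol z (0 - a) + duhamelSin q a z 0) := by
      refine intervalIntegral.integral_eq_sub_of_hasDerivAt (f := fun t =>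
        z * (sinSol z (t - a) + duhamelSin q a z t)) (fun t _ => ?_)
        ((hC.const_mul z).intervalIntegrable _ _)
      exact (((hasDerivAt_sinSol z (t - a)).comp_sub_const t a).add
        (hasDerivAt_duhamelSin hq a z t)).const_mul z
    rw [h1, h2]
    unfold solC'
    ring

omit hq in
lemma hasDerivAt_solS : HasDerivAt (solS a z) (cosSol z (x - a)) x :=
  (hasDerivAt_sinSol z (x - a)).comp_sub_const x a

omit hq in
lemma isSolution_solS : IsSolution q a z (solS a z) := by
  apply isSolution_of_hasDerivWithinAt (g := fun x => cosSol z (x - a))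
  · intro x _
    exact (hasDerivAt_solS a z x).hasDerivWithinAt
  · intro x _
    have hS : Continuous (solS a z) :=
      continuous_iff_continuousAt.2 fun t => (hasDerivAt_solS a z t).continuousAt
    have ha : solS a z a = 0 := by simp [solS]
    have h2 : (∫ t in (0 : ℝ)..x, (q t * solS a z a - z * solS a z t))
        = cosSol z (x - a) - cosSol z (0 - a) := by
      simp only [ha, mul_zero, zero_sub]
      refine intervalIntegral.integral_eq_sub_of_hasDerivAt (f := fun t => cosSol z (t - a))
        (fun t _ => ?_) ((hS.const_mul z).neg.intervalIntegrable _ _) |>.trans (by simp)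
      exact ((hasDerivAt_cosSol z (t - a)).comp_sub_const t a).congr_deriv (by simp [solS])
    rw [h2]; ring

lemma isFundamentalSystem_sol (ha : a ∈ Icc 0 Real.pi) :
    IsFundamentalSystem q a (solC q a) (solS a) where
  solution_C := isSolution_solC hq a
  solution_S := isSolution_solS a
  C_a z := by simp [solC, duhamelCos, cosMoment, sinMoment]
  der_C_a z := by
    rw [der_one_eq ha (hasDerivAt_solC hq a z a).hasDerivWithinAt]
    simp [solC', duhamelSin, cosMoment, sinMoment, primitive]
  S_a z := by simp [solS]
  der_S_a z := by
    rw [der_one_eq ha (hasDerivAt_solS a z a).hasDerivWithinAt]; simp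

/-- Continuity in `z` is all that is needed: analyticity follows later from the factorization, by
removing the singularities at the unperturbed eigenvalues. -/
lemma continuous_charFun {α β : ℕ} (hα : α = 0 ∨ α = 1) (hβ : β = 0 ∨ β = 1) :
    Continuous (charFun α β (solC q a) (solS a)) := by
  have hc : ∀ x : ℝ, Continuous fun z => cosSol z x := fun x =>
    continuous_cosSol.comp (f := fun z : ℂ => (z, x)) (by fun_prop)
  have hs : ∀ x : ℝ, Continuous fun z => sinSol z x := fun x =>
    continuous_sinSol.comp (f := fun z : ℂ => (z, x)) (by fun_prop)
  have hQ := continuous_primitive hq a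
  have hcm : ∀ x : ℝ, Continuous fun z => cosMoment q a z x := fun x =>
    intervalIntegral.continuous_parametric_intervalIntegral_of_continuous'
      (f := fun z t => cosSol z t * primitive q a t)
      (continuous_cosSol.mul (hQ.comp continuous_snd)) a x
  have hsm : ∀ x : ℝ, Continuous fun z => sinMoment q a z x := fun x =>
    intervalIntegral.continuous_parametric_intervalIntegral_of_continuous'
      (f := fun z t => sinSol z t * primitive q a t)
      (continuous_sinSol.mul (hQ.comp continuous_snd)) a x
  have h1 : ∀ m : ℕ, m = 0 ∨ m = 1 → ∀ x ∈ Icc 0 Real.pi,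
      Continuous fun z => der m (solC q a z) x := by
    rintro m (rfl | rfl) x hx
    · simp only [der_zero]
      have := hc (x - a); have := hc x; have := hs x; have := hcm x; have := hsm x
      unfold solC duhamelCos
      fun_prop
    · have : (fun z => der 1 (solC q a z) x) = fun z => solC' q a z x := by
        ext z; exact der_one_eq hx (hasDerivAt_solC hq a z x).hasDerivWithinAt
      rw [this]
      have := hs (x - a); have := hc x; have := hs x; have := hcm x; have := hsm x
      unfold solC' duhamelSin
      fun_prop
  have h2 : ∀ m : ℕ, m = 0 ∨ m = 1 → ∀ x ∈ Icc 0 Real.pi,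
      Continuous fun z => der m (solS a z) x := by
    rintro m (rfl | rfl) x hx
    · simp only [der_zero]
      exact hs _
    · have : (fun z => der 1 (solS a z) x) = fun z => cosSol z (x - a) := by
        ext z; exact der_one_eq hx (hasDerivAt_solS a z x).hasDerivWithinAt
      rw [this]
      exact hc _
  have : charFun α β (solC q a) (solS a) = fun z =>
      der α (solC q a z) 0 * der β (solS a z) Real.pi
        - der α (solS a z) 0 * der β (solC q a z) Real.pi := by
    ext z; exact charFun_eq _ _ _ _ _
  rw [this]
  exact ((h1 α hα 0 zero_mem_segment).mul (h2 β hβ _ pi_mem_segment)).sub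
    ((h2 α hα 0 zero_mem_segment).mul (h1 β hβ _ pi_mem_segment))

end

open Filter Topology

/-! ### Partial fractions of a product -/

/-- The coefficients of the partial fraction expansion of `∏_{n ∈ s} (1 + d n / (μ n - z))`. The
factor with `n = m` equals `1`. -/
def partialCoeff {ι : Type*} (μ d : ι → ℂ) (s : Finset ι) (m : ι) : ℂ :=
  d m * ∏ n ∈ s, (1 + d n / (μ n - μ m))

/-- The coefficients of the partial fraction expansion of `∏ₙ (1 + d n / (μ n - z))`. -/
def fractionCoeff {ι : Type*} (μ d : ι → ℂ) (m : ι) : ℂ :=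
  d m * ∏' n, (1 + d n / (μ n - μ m))

/-- The induction is over `s` for all `z` at once, because the residue at a new pole `μ j` is
governed by the old product at `z = μ j`. The cross terms are split by partial fractions of `1 / ((μ
m - z) (μ j - z))`. -/
lemma prod_eq_one_add_sum {ι : Type*} {μ : ι → ℂ} (hμ : Function.Injective μ) (d : ι → ℂ)
    (s : Finset ι) : ∀ z : ℂ, (∀ m ∈ s, μ m ≠ z) →
      ∏ n ∈ s, (1 + d n / (μ n - z)) = 1 + ∑ m ∈ s, partialCoeff μ d s m / (μ m - z) := by
  classical
  induction s using Finset.induction_on with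
  | empty => simp
  | insert j s hj ih =>
    intro z hz
    have hzs : ∀ m ∈ s, μ m ≠ z := fun m hm => hz m (Finset.mem_insert_of_mem hm)
    have hzj : μ j - z ≠ 0 := sub_ne_zero.2 (hz j (Finset.mem_insert_self _ _))
    have hne : ∀ m ∈ s, μ m ≠ μ j := fun m hm h => hj (hμ h ▸ hm)
    have e1 : ∀ m ∈ s, partialCoeff μ d (insert j s) m
        = partialCoeff μ d s m * (1 + d j / (μ j - μ m)) := by
      intro m _
      simp only [partialCoeff, Finset.prod_insert hj]; ring
    -- The factor `n = j` is `1 + d j / 0 = 1` by the convention for division by zero.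
    have e2 : partialCoeff μ d (insert j s) j
        = d j * (1 + ∑ m ∈ s, partialCoeff μ d s m / (μ m - μ j)) := by
      rw [partialCoeff, Finset.prod_insert hj, ih (μ j) hne]; simp
    rw [Finset.prod_insert hj, Finset.sum_insert hj, ih z hzs, e2]
    have e3 : ∑ m ∈ s, partialCoeff μ d (insert j s) m / (μ m - z)
        = ∑ m ∈ s, (partialCoeff μ d s m / (μ m - z)
          + d j / (μ j - z) * (partialCoeff μ d s m / (μ m - z)
            - partialCoeff μ d s m / (μ m - μ j))) := by
      refine Finset.sum_congr rfl fun m hm => ?_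
      rw [e1 m hm]
      have h1 : μ m - z ≠ 0 := sub_ne_zero.2 (hzs m hm)
      have h2 : μ m - μ j ≠ 0 := sub_ne_zero.2 (hne m hm)
      have h3 : μ j - μ m ≠ 0 := sub_ne_zero.2 (hne m hm).symm
      have h4 : d j / (μ j - μ m) = -(d j / (μ m - μ j)) := by
        rw [← div_neg, neg_sub]
      rw [h4]
      field_simp
      ring
    rw [e3, Finset.sum_add_distrib, ← Finset.mul_sum, Finset.sum_sub_distrib]
    ring

lemma norm_prod_one_add_le {ι : Type*} (f : ι → ℂ) (s : Finset ι) :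
    ‖∏ n ∈ s, (1 + f n)‖ ≤ Real.exp (∑ n ∈ s, ‖f n‖) := by
  rw [norm_prod, Real.exp_sum]
  refine Finset.prod_le_prod (fun _ _ => norm_nonneg _) fun n _ => ?_
  calc ‖1 + f n‖ ≤ 1 + ‖f n‖ := by simpa using norm_add_le (1 : ℂ) (f n)
    _ ≤ Real.exp ‖f n‖ := by rw [add_comm]; exact Real.add_one_le_exp _

section
variable {ι : Type*} {μ d : ι → ℂ} {M : ℝ}
  (hM : ∀ m, Summable (fun n => ‖d n / (μ n - μ m)‖) ∧ ∑' n, ‖d n / (μ n - μ m)‖ ≤ M)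
include hM

/-- Uniformity in `s` supplies the majorant for passing to the infinite product; uniformity in `m`
keeps the limiting coefficients in `ℓ₂` when `d` is. -/
lemma norm_partialCoeff_le (s : Finset ι) (m : ι) :
    ‖partialCoeff μ d s m‖ ≤ Real.exp M * ‖d m‖ := by
  rw [partialCoeff, norm_mul, mul_comm]
  gcongr
  refine (norm_prod_one_add_le _ _).trans (Real.exp_le_exp.2 ?_)
  exact ((hM m).1.sum_le_tsum s (fun _ _ => norm_nonneg _)).trans (hM m).2

lemma tendsto_partialCoeff (m : ι) :
    Tendsto (fun s => partialCoeff μ d s m) atTop (𝓝 (fractionCoeff μ d m)) :=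
  ((multipliable_one_add_of_summable (hM m).1).hasProd).const_mul (d m)

lemma norm_fractionCoeff_le (m : ι) : ‖fractionCoeff μ d m‖ ≤ Real.exp M * ‖d m‖ :=
  le_of_tendsto (tendsto_partialCoeff hM m).norm
    (Eventually.of_forall fun s => norm_partialCoeff_le hM s m)

/-- Partial fraction expansion of an infinite product. -/
lemma tprod_eq_one_add_tsum (hμ : Function.Injective μ) {z : ℂ} (hz : ∀ m, μ m ≠ z)
    (hs : Summable fun n => ‖d n / (μ n - z)‖) :
    ∏' n, (1 + d n / (μ n - z)) = 1 + ∑' m, fractionCoeff μ d m / (μ m - z) := by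
  classical
  have h1 : Tendsto (fun s : Finset ι => ∏ n ∈ s, (1 + d n / (μ n - z))) atTop
      (𝓝 (∏' n, (1 + d n / (μ n - z)))) := (multipliable_one_add_of_summable hs).hasProd
  -- Dominated convergence for series, with majorant `exp M * ‖d m / (μ m - z)‖`.
  have h2 : Tendsto (fun s : Finset ι =>
      ∑' m, (if m ∈ s then partialCoeff μ d s m / (μ m - z) else 0)) atTop
      (𝓝 (∑' m, fractionCoeff μ d m / (μ m - z))) := by
    refine tendsto_tsum_of_dominated_convergence (hs.mul_left (Real.exp M)) (fun m => ?_)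
      (Eventually.of_forall fun s m => ?_)
    · refine ((tendsto_partialCoeff hM m).div_const (μ m - z)).congr' ?_
      filter_upwards [eventually_ge_atTop {m}] with s hs
      rw [if_pos (hs (Finset.mem_singleton_self m))]
    · split_ifs
      · rw [norm_div, norm_div, ← mul_div_assoc]
        gcongr
        exact norm_partialCoeff_le hM s m
      · rw [norm_zero]; positivity
  refine tendsto_nhds_unique h1 ((h2.const_add 1).congr fun s => ?_)
  rw [prod_eq_one_add_sum hμ d s z fun m _ => hz m, tsum_eq_sum (s := s) fun m hm => if_neg hm]
  congr 1
  exact Finset.sum_congr rfl fun m hm => if_pos hm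

end

/-! ### Multiplicities of zeros of a product -/

lemma analyticOrderAt_const_sub (v z₀ : ℂ) :
    analyticOrderAt (fun z => v - z) z₀ = if v = z₀ then 1 else 0 := by
  have ha : AnalyticAt ℂ (fun z => v - z) z₀ := by fun_prop
  split_ifs with h
  · have hd : HasDerivAt (fun z => v - z) (-1) z₀ := by
      simpa using (hasDerivAt_id z₀).const_sub v
    have := ha.analyticOrderAt_sub_eq_one_of_deriv_ne_zero (by rw [hd.deriv]; simp)
    simpa [h] using this
  · exact ha.analyticOrderAt_eq_zero.2 (sub_ne_zero.2 h)

lemma analyticOrderAt_prod_sub {ι : Type*} (v : ι → ℂ) (s : Finset ι) (z₀ : ℂ) [DecidableEq ι] :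
    analyticOrderAt (fun z => ∏ n ∈ s, (v n - z)) z₀ = (s.filter fun n => v n = z₀).card := by
  induction s using Finset.induction_on with
  | empty =>
    simp only [Finset.prod_empty]
    rw [AnalyticAt.analyticOrderAt_eq_zero analyticAt_const |>.2 one_ne_zero]; simp
  | insert j s hj ih =>
    simp only [Finset.prod_insert hj]
    have h1 : AnalyticAt ℂ (fun z => v j - z) z₀ := by fun_prop
    have h2 : AnalyticAt ℂ (fun z => ∏ n ∈ s, (v n - z)) z₀ := by fun_prop
    rw [show (fun z => (v j - z) * ∏ n ∈ s, (v n - z))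
      = (fun z => v j - z) * (fun z => ∏ n ∈ s, (v n - z)) from rfl,
      analyticOrderAt_mul h1 h2, ih, analyticOrderAt_const_sub, Finset.filter_insert]
    split_ifs
    · rw [Finset.card_insert_of_notMem (by simp [hj])]; push_cast; rw [add_comm]
    · simp

lemma encard_fiber_eq {ι : Type*} [DecidableEq ι] {v : ι → ℂ} {z₀ : ℂ} {s : Finset ι}
    (h : ∀ n ∉ s, v n ≠ z₀) : {n | v n = z₀}.encard = (s.filter fun n => v n = z₀).card := by
  rw [← Set.encard_coe_eq_coe_finsetCard]
  congr 1
  ext n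
  simp only [mem_ofPred_eq, Finset.coe_filter]
  exact ⟨fun hn => ⟨by_contra fun hs => h n hs hn, hn⟩, fun hn => hn.2⟩

/-- If `D` is an entire function with zeros `μ n` (with multiplicities), then
`D z * ∏ₙ (lam n - z) / (μ n - z)` has the zeros `lam n` (with multiplicities). -/
lemma analyticAt_and_order_of_eq_mul_tprod {ι : Type*} {μ lam : ι → ℂ} {F D : ℂ → ℂ}
    (hF : Continuous F) (hD : Differentiable ℂ D)
    (hμ : Tendsto (fun n => ‖μ n‖) cofinite atTop)
    (hd : Summable fun n => ‖lam n - μ n‖ / (1 + ‖μ n‖))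
    (hord : ∀ z, {n | μ n = z}.encard = analyticOrderAt D z)
    (hFD : ∀ z, (∀ n, μ n ≠ z) → F z = D z * ∏' n, (1 + (lam n - μ n) / (μ n - z)))
    (z₀ : ℂ) :
    AnalyticAt ℂ F z₀ ∧ {n | lam n = z₀}.encard = analyticOrderAt F z₀ := by
  classical
  -- The factor `4`: if `‖μ n‖ ≥ 2 (‖z₀‖ + 1)`, then on the unit ball around `z₀` one has `‖μ n - z‖
  -- ≥ ‖μ n‖ / 2 ≥ (1 + ‖μ n‖) / 4`. The finitely many other indices, and those with `u n ≥ 1`, go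
  -- into `s`.
  set u : ι → ℝ := fun n => 4 * (‖lam n - μ n‖ / (1 + ‖μ n‖)) with hu
  have hus : Summable u := hd.mul_left 4
  have hev : ∀ᶠ n in cofinite, 2 * (‖z₀‖ + 1) ≤ ‖μ n‖ ∧ u n < 1 :=
    (hμ.eventually_ge_atTop _).and (hus.tendsto_cofinite_zero.eventually_lt_const one_pos)
  set s : Finset ι := (eventually_cofinite.1 hev).toFinset with hsdef
  have hs : ∀ n ∉ s, 2 * (‖z₀‖ + 1) ≤ ‖μ n‖ ∧ u n < 1 := by
    intro n hn
    simpa [hsdef, -not_and] using hn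
  have hball : ∀ n ∉ s, ∀ z ∈ Metric.ball z₀ 1, ‖μ n‖ / 2 ≤ ‖μ n - z‖ ∧ μ n ≠ z := by
    intro n hn z hz
    have h1 := (hs n hn).1
    have h2 : ‖z‖ < ‖z₀‖ + 1 := by
      have := norm_le_norm_add_norm_sub' z z₀
      have h3 : ‖z - z₀‖ < 1 := by simpa [dist_eq_norm] using hz
      linarith
    have h3 : ‖μ n‖ - ‖z‖ ≤ ‖μ n - z‖ := norm_sub_norm_le _ _
    refine ⟨by linarith, ?_⟩
    rintro rfl
    have := norm_nonneg z₀
    linarith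
  set f : ι → ℂ → ℂ := fun n z => if n ∈ s then 0 else (lam n - μ n) / (μ n - z) with hf
  have hfu : ∀ n, ∀ z ∈ Metric.ball z₀ 1, ‖f n z‖ ≤ u n := by
    intro n z hz
    simp only [hf]
    split_ifs with h
    · rw [norm_zero]; positivity
    · have h1 := (hball n h z hz).1
      have h2 : (1 + ‖μ n‖) / 4 ≤ ‖μ n‖ / 2 := by
        have := (hs n h).1
        have := norm_nonneg z₀
        linarith
      rw [norm_div, hu]
      calc ‖lam n - μ n‖ / ‖μ n - z‖ ≤ ‖lam n - μ n‖ / ((1 + ‖μ n‖) / 4) := by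
            gcongr; exact h2.trans h1
        _ = 4 * (‖lam n - μ n‖ / (1 + ‖μ n‖)) := by field_simp
  have hfd : ∀ n, DifferentiableOn ℂ (f n) (Metric.ball z₀ 1) := by
    intro n
    by_cases h : n ∈ s
    · simp only [hf, h, if_true]; exact differentiableOn_const _
    · simp only [hf, h, if_false]
      exact (differentiableOn_const _).div (by fun_prop)
        fun z hz => sub_ne_zero.2 (hball n h z hz).2
  set T : ℂ → ℂ := fun z => ∏' n, (1 + f n z) with hT
  have hTd : DifferentiableOn ℂ T (Metric.ball z₀ 1) := by
    have := (Summable.hasProdLocallyUniformlyOn_one_add (f := f) Metric.isOpen_ball hus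
      (Eventually.of_forall hfu) fun n => (hfd n).continuousOn)
    rw [hasProdLocallyUniformlyOn_iff_tendstoLocallyUniformlyOn] at this
    exact this.differentiableOn (Eventually.of_forall fun t =>
      DifferentiableOn.fun_finsetProd fun n _ => (hfd n).const_add 1) Metric.isOpen_ball
  have hz₀ : z₀ ∈ Metric.ball z₀ 1 := Metric.mem_ball_self one_pos
  have hTa : AnalyticAt ℂ T z₀ := hTd.analyticAt (Metric.ball_mem_nhds _ one_pos)
  have hsum : ∀ z ∈ Metric.ball z₀ 1, Summable fun n => ‖f n z‖ := fun z hz =>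
    hus.of_nonneg_of_le (fun _ => norm_nonneg _) fun n => hfu n z hz
  -- Outside `s` the bound `u n < 1` keeps every factor of the tail product away from zero.
  have hT0 : T z₀ ≠ 0 := by
    refine tprod_one_add_ne_zero_of_summable (fun n h => ?_) (hsum z₀ hz₀)
    have h1 : ‖f n z₀‖ = 1 := by rw [eq_neg_of_add_eq_zero_right h]; simp
    have h2 := hfu n z₀ hz₀
    by_cases hn : n ∈ s
    · simp [hf, hn] at h1
    · linarith [(hs n hn).2]
  set P : ℂ → ℂ := fun z => ∏ n ∈ s, (μ n - z) with hP
  set R : ℂ → ℂ := fun z => ∏ n ∈ s, (lam n - z) with hR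
  have hPa : Differentiable ℂ P := by
    simp only [hP]; fun_prop
  have hRa : Differentiable ℂ R := by
    simp only [hR]; fun_prop
  have hpunct : ∀ᶠ z in 𝓝[≠] z₀, z ∈ Metric.ball z₀ 1 ∧ ∀ n ∈ s, μ n ≠ z := by
    have hb : ∀ᶠ z in 𝓝[≠] z₀, z ∈ Metric.ball z₀ 1 :=
      mem_nhdsWithin_of_mem_nhds (Metric.ball_mem_nhds _ one_pos)
    refine hb.and ?_
    rw [eventually_all_finset]
    intro n _
    by_cases h : μ n = z₀
    · filter_upwards [self_mem_nhdsWithin] with z hz h'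
      exact hz (h'.symm.trans h)
    · filter_upwards [mem_nhdsWithin_of_mem_nhds (isOpen_ne.mem_nhds (Ne.symm h))] with z hz
        using Ne.symm hz
  have key : ∀ z, z ∈ Metric.ball z₀ 1 ∧ (∀ n ∈ s, μ n ≠ z) →
      P z ≠ 0 ∧ F z * P z = D z * R z * T z := by
    rintro z ⟨hz, hne⟩
    have hall : ∀ n, μ n ≠ z := fun n => by
      by_cases h : n ∈ s
      · exact hne n h
      · exact (hball n h z hz).2
    have hP0 : P z ≠ 0 := Finset.prod_ne_zero_iff.2 fun n hn => sub_ne_zero.2 (hne n hn)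
    refine ⟨hP0, ?_⟩
    have hprod : ∏' n, (1 + (lam n - μ n) / (μ n - z))
        = (∏ n ∈ s, (1 + (lam n - μ n) / (μ n - z))) * T z := by
      have e : ∀ n, 1 + (lam n - μ n) / (μ n - z)
          = (if n ∈ s then 1 + (lam n - μ n) / (μ n - z) else 1) * (1 + f n z) := by
        intro n
        simp only [hf]
        split_ifs <;> simp
      rw [tprod_congr e, Multipliable.tprod_mul
        (multipliable_of_ne_finset_one (s := s) fun n hn => if_neg hn)
        (multipliable_one_add_of_summable (hsum z hz)),
        tprod_eq_prod (s := s) fun n hn => if_neg hn]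
      congr 1
      exact Finset.prod_congr rfl fun n hn => if_pos hn
    have hPR : (∏ n ∈ s, (1 + (lam n - μ n) / (μ n - z))) * P z = R z := by
      simp only [hP, hR]
      rw [← Finset.prod_mul_distrib]
      refine Finset.prod_congr rfl fun n hn => ?_
      have := sub_ne_zero.2 (hne n hn)
      field_simp
      ring
    rw [hFD z hall, hprod, ← hPR]; ring
  have hFa : AnalyticAt ℂ F z₀ := by
    refine Complex.analyticAt_of_differentiable_on_punctured_nhds_of_continuousAt ?_
      hF.continuousAt
    have h2 := hpunct
    rw [eventually_nhdsWithin_iff, ← eventually_eventually_nhds] at h2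
    filter_upwards [eventually_nhdsWithin_of_eventually_nhds h2, hpunct, self_mem_nhdsWithin]
      with z hz hz' hzne
    have hd : DifferentiableAt ℂ (fun w => D w * R w * T w / P w) z :=
      (((hD z).mul (hRa z)).mul (hTd.differentiableAt (Metric.isOpen_ball.mem_nhds hz'.1))).div
        (hPa z) (key z hz').1
    refine hd.congr_of_eventuallyEq ?_
    filter_upwards [hz, isOpen_ne.mem_nhds hzne] with w hw hw'
    obtain ⟨h1, h2⟩ := key w (hw hw')
    rw [← h2, mul_div_cancel_right₀ _ h1]
  refine ⟨hFa, ?_⟩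
  have hPan : AnalyticAt ℂ P z₀ := hPa.analyticAt z₀
  have hRan : AnalyticAt ℂ R z₀ := hRa.analyticAt z₀
  have hDan : AnalyticAt ℂ D z₀ := hD.analyticAt z₀
  -- Comparing orders at `z₀`: the order of `P` equals that of `D`, both counting the `μ n = z₀`,
  -- and `T` has order zero. Cancelling this finite number leaves the order of `F` equal to that of
  -- `R`.
  have heq : F * P =ᶠ[𝓝 z₀] D * R * T := by
    rw [← ContinuousAt.eventuallyEq_nhds_iff_eventuallyEq_nhdsNE (hFa.mul hPan).continuousAt
      ((hDan.mul hRan).mul hTa).continuousAt]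
    filter_upwards [hpunct] with z hz using (key z hz).2
  have h := analyticOrderAt_congr heq
  rw [analyticOrderAt_mul hFa hPan, analyticOrderAt_mul (hDan.mul hRan) hTa,
    analyticOrderAt_mul hDan hRan, hTa.analyticOrderAt_eq_zero.2 hT0, add_zero, ← hord,
    hP, hR, analyticOrderAt_prod_sub, analyticOrderAt_prod_sub,
    encard_fiber_eq (s := s) fun n hn => (hball n hn z₀ hz₀).2, add_comm] at h
  rw [encard_fiber_eq (s := s) (v := lam),
    ENat.add_right_injective_of_ne_top (ENat.natCast_ne_top _) h]
  -- For `n` outside `s`, `lam n = z₀` would force `f n z₀ = -1`, against `u n < 1`.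
  intro n hn hlam
  have h1 := hball n hn z₀ hz₀
  have h2 := hfu n z₀ hz₀
  simp only [hf, hn, if_false, hlam] at h2
  rw [← neg_sub, neg_div, div_self (sub_ne_zero.2 h1.2)] at h2
  norm_num at h2
  linarith [(hs n hn).2]

/-! ### Eigenfunctions of the unperturbed problem -/

/-- The square root of the `m`-th eigenvalue of the unperturbed problem. -/
def freq (α β : ℕ) (m : ℕ+) : ℝ := (m : ℝ) - ((α : ℝ) + β) / 2

/-- The `m`-th eigenfunction of the unperturbed problem. -/
def eig (α β : ℕ) (m : ℕ+) (x : ℝ) : ℝ :=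
  if α = 0 then Real.sin (freq α β m * x) else Real.cos (freq α β m * x)

/-- The derivative of the `m`-th eigenfunction. -/
def eig' (α β : ℕ) (m : ℕ+) (x : ℝ) : ℝ :=
  if α = 0 then freq α β m * Real.cos (freq α β m * x)
  else -(freq α β m * Real.sin (freq α β m * x))

section
variable {α β : ℕ} (hα : α = 0 ∨ α = 1) (hβ : β = 0 ∨ β = 1)

lemma hasDerivAt_eig (m : ℕ+) (x : ℝ) : HasDerivAt (eig α β m) (eig' α β m x) x := by
  have h : HasDerivAt (fun x : ℝ => freq α β m * x) (freq α β m) x := by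
    simpa using (hasDerivAt_id x).const_mul (freq α β m)
  unfold eig eig'
  split_ifs
  · exact h.sin.congr_deriv (by ring)
  · exact h.cos.congr_deriv (by ring)

lemma hasDerivAt_eig' (m : ℕ+) (x : ℝ) :
    HasDerivAt (eig' α β m) (-(freq α β m ^ 2 * eig α β m x)) x := by
  have h : HasDerivAt (fun x : ℝ => freq α β m * x) (freq α β m) x := by
    simpa using (hasDerivAt_id x).const_mul (freq α β m)
  unfold eig eig'
  split_ifs
  · exact (h.cos.const_mul (freq α β m)).congr_deriv (by ring)
  · exact (h.sin.const_mul (freq α β m)).neg.congr_deriv (by ring)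

lemma continuous_eig (m : ℕ+) : Continuous (eig α β m) :=
  continuous_iff_continuousAt.2 fun x => (hasDerivAt_eig m x).continuousAt

lemma abs_eig_le (m : ℕ+) (x : ℝ) : |eig α β m x| ≤ 1 := by
  unfold eig
  split_ifs
  · exact Real.abs_sin_le_one _
  · exact Real.abs_cos_le_one _

include hα hβ in
lemma freq_bounds (m : ℕ+) : (m : ℝ) - 1 ≤ freq α β m ∧ freq α β m ≤ m := by
  unfold freq
  rcases hα with rfl | rfl <;> rcases hβ with rfl | rfl <;> norm_num <;> linarith

include hα hβ in
lemma freq_nonneg (m : ℕ+) : 0 ≤ freq α β m := by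
  have h1 : (1 : ℝ) ≤ m := Nat.one_le_cast.2 m.pos
  linarith [(freq_bounds hα hβ m).1]

include hα hβ in
lemma abs_eig'_le (m : ℕ+) (x : ℝ) : |eig' α β m x| ≤ freq α β m := by
  have h := freq_nonneg hα hβ m
  unfold eig'
  split_ifs
  · rw [abs_mul, abs_of_nonneg h]
    exact mul_le_of_le_one_right h (Real.abs_cos_le_one _)
  · rw [abs_neg, abs_mul, abs_of_nonneg h]
    exact mul_le_of_le_one_right h (Real.abs_sin_le_one _)

include hα hβ in
lemma freq_sq_injective : Function.Injective fun m => freq α β m ^ 2 := by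
  intro m n h
  have h1 := (sq_eq_sq₀ (freq_nonneg hα hβ m) (freq_nonneg hα hβ n)).1 h
  unfold freq at h1
  have : (m : ℝ) = n := by linarith
  exact_mod_cast this

include hα hβ in
lemma freq_sq_cast_injective : Function.Injective fun m => (freq α β m : ℂ) ^ 2 := by
  intro m n h
  have h' : (freq α β m : ℂ) ^ 2 = (freq α β n : ℂ) ^ 2 := h
  have h2 : freq α β m ^ 2 = freq α β n ^ 2 := by exact_mod_cast h'
  exact freq_sq_injective hα hβ h2

lemma eig_zero (h : α = 0) (m : ℕ+) : eig α β m 0 = 0 := by simp [eig, h]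

lemma eig'_zero (h : α = 1) (m : ℕ+) : eig' α β m 0 = 0 := by simp [eig', h]

include hα in
lemma eig_pi (h : β = 0) (m : ℕ+) : eig α β m Real.pi = 0 := by
  subst h
  rcases hα with rfl | rfl
  · simp [eig, freq]
  · simp only [eig, freq, one_ne_zero, if_false]
    rw [Real.cos_eq_zero_iff]
    exact ⟨(m : ℤ) - 1, by push_cast; ring⟩

include hα in
lemma eig'_pi (h : β = 1) (m : ℕ+) : eig' α β m Real.pi = 0 := by
  subst h
  rcases hα with rfl | rfl
  · simp only [eig', freq, if_true, mul_eq_zero]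
    right
    rw [Real.cos_eq_zero_iff]
    exact ⟨(m : ℤ) - 1, by push_cast; ring⟩
  · simp only [eig', freq, one_ne_zero, if_false, neg_eq_zero, mul_eq_zero]
    right
    rw [Real.sin_eq_zero_iff]
    exact ⟨(m : ℤ) - 1, by push_cast; ring⟩

include hα hβ in
lemma exists_eig_ne_zero (m : ℕ+) : ∃ x ∈ Ioo 0 Real.pi, eig α β m x ≠ 0 := by
  have h := freq_nonneg hα hβ m
  have hpi := Real.pi_pos
  -- At this point the argument of the sine or cosine lies in `[0, π/2)`, and it is positive in the
  -- sine case since then the frequency is positive.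
  refine ⟨Real.pi / (4 * (freq α β m + 1)), ⟨by positivity, ?_⟩, ?_⟩
  · rw [div_lt_iff₀ (by positivity)]; nlinarith
  · have h2 : freq α β m * (Real.pi / (4 * (freq α β m + 1))) < Real.pi / 2 := by
      rw [← mul_div_assoc, div_lt_div_iff₀ (by positivity) (by positivity)]; nlinarith
    unfold eig
    split_ifs with h0
    · have h1 : (1 : ℝ) ≤ m := Nat.one_le_cast.2 m.pos
      have : 0 < freq α β m := by
        unfold freq; subst h0
        rcases hβ with rfl | rfl
        · norm_num
        · norm_num; linarith
      exact (Real.sin_pos_of_pos_of_lt_pi (by positivity) (by linarith)).ne'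
    · refine (Real.cos_pos_of_mem_Ioo ⟨?_, h2⟩).ne'
      have : 0 ≤ freq α β m * (Real.pi / (4 * (freq α β m + 1))) := by positivity
      linarith

include hα hβ in
-- The Wronskian of two eigenfunctions has derivative `(μ m - μ n)` times their product, and it
-- vanishes at both ends by the boundary conditions.
lemma integral_eig_mul_eig {m n : ℕ+} (hmn : m ≠ n) :
    ∫ x in (0 : ℝ)..Real.pi, eig α β m x * eig α β n x = 0 := by
  have hd : ∀ x, HasDerivAt (fun x => eig α β m x * eig' α β n x - eig' α β m x * eig α β n x)
      ((freq α β m ^ 2 - freq α β n ^ 2) * (eig α β m x * eig α β n x)) x := fun x =>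
    (((hasDerivAt_eig m x).mul (hasDerivAt_eig' n x)).sub
      ((hasDerivAt_eig' m x).mul (hasDerivAt_eig n x))).congr_deriv (by ring)
  have hc : Continuous fun x => eig α β m x * eig α β n x :=
    (continuous_eig m).mul (continuous_eig n)
  have h := intervalIntegral.integral_eq_sub_of_hasDerivAt (a := 0) (b := Real.pi)
    (fun x _ => hd x) ((hc.const_mul _).intervalIntegrable _ _)
  rw [intervalIntegral.integral_const_mul] at h
  have h0 : eig α β m 0 * eig' α β n 0 - eig' α β m 0 * eig α β n 0 = 0 := by
    rcases hα with h | h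
    · simp [eig_zero h]
    · simp [eig'_zero h]
  have h1 : eig α β m Real.pi * eig' α β n Real.pi - eig' α β m Real.pi * eig α β n Real.pi = 0 := by
    rcases hβ with h | h
    · simp [eig_pi hα h]
    · simp [eig'_pi hα h]
  rw [h0, h1, sub_zero] at h
  exact (mul_eq_zero.1 h).resolve_left
    (sub_ne_zero.2 fun h => hmn (freq_sq_injective hα hβ h))

/-! ### Synthesis of a potential from its coefficients -/

/-- `q` is the sum of the series `∑ b m * eig m` in `L₂(0, π)`, in the sense of
antiderivatives. -/
structure HasExpansion (α β : ℕ) (b : ℕ+ → ℂ) (q : ℝ → ℂ) : Prop where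
  integrable : Integrable q
  isL2 : IsL2 q
  hasSum : ∀ x ∈ Icc 0 Real.pi,
    HasSum (fun m => b m * ∫ t in (0 : ℝ)..x, (eig α β m t : ℂ)) (∫ t in (0 : ℝ)..x, q t)

lemma memLp_eig (m : ℕ+) :
    MemLp (fun x => (eig α β m x : ℂ)) 2 (volume.restrict (Ioo 0 Real.pi)) := by
  refine MemLp.of_bound (Complex.continuous_ofReal.comp (continuous_eig m)).aestronglyMeasurable 1
    (ae_of_all _ fun x => ?_)
  rw [Complex.norm_real]
  exact abs_eig_le m x

/-- The eigenfunctions as elements of the Hilbert space. -/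
def eigLp (α β : ℕ) (m : ℕ+) : Lp ℂ 2 (volume.restrict (Ioo 0 Real.pi)) :=
  (memLp_eig (α := α) (β := β) m).toLp _

lemma integral_Ioo_eq (f : ℝ → ℂ) :
    ∫ x in Ioo 0 Real.pi, f x = ∫ x in (0 : ℝ)..Real.pi, f x := by
  rw [intervalIntegral.integral_of_le Real.pi_pos.le, integral_Ioc_eq_integral_Ioo]

include hα hβ in
lemma inner_eigLp {m n : ℕ+} (hmn : m ≠ n) :
    inner ℂ (eigLp α β m) (eigLp α β n) = 0 := by
  rw [L2.inner_def]
  have : (fun x => inner ℂ (eigLp α β m x) (eigLp α β n x))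
      =ᵐ[volume.restrict (Ioo 0 Real.pi)] fun x => ((eig α β m x * eig α β n x : ℝ) : ℂ) := by
    filter_upwards [(memLp_eig (α := α) (β := β) m).coeFn_toLp,
      (memLp_eig (α := α) (β := β) n).coeFn_toLp] with x h1 h2
    unfold eigLp
    rw [h1, h2]
    simp [mul_comm]
  rw [integral_congr_ae this, integral_Ioo_eq, intervalIntegral.integral_ofReal,
    integral_eig_mul_eig hα hβ hmn, Complex.ofReal_zero]

lemma norm_eigLp_le : ∃ K : ℝ, ∀ m, ‖eigLp α β m‖ ≤ K := by
  refine ⟨_, fun m => Lp.norm_le_of_ae_bound (C := 1) zero_le_one ?_⟩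
  filter_upwards [(memLp_eig (α := α) (β := β) m).coeFn_toLp] with x h1
  unfold eigLp
  rw [h1, Complex.norm_real]
  exact abs_eig_le m x

include hα hβ in
-- For an orthogonal family convergence amounts to square summability of the norms. Bounded norms
-- suffice; neither normalization nor completeness of the eigenfunctions plays a role.
lemma summable_smul_eigLp {b : ℕ+ → ℂ} (hb : Summable fun m => ‖b m‖ ^ 2) :
    Summable fun m => b m • eigLp α β m := by
  obtain ⟨K, hK⟩ := norm_eigLp_le (α := α) (β := β)
  have hV : OrthogonalFamily ℂ (fun m => Submodule.span ℂ {eigLp α β m})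
      fun m => (Submodule.span ℂ {eigLp α β m}).subtypeₗᵢ := by
    refine OrthogonalFamily.of_pairwise fun m n hmn => ?_
    refine Submodule.isOrtho_span.2 ?_
    rintro u rfl v rfl
    exact inner_eigLp hα hβ hmn
  have := (hV.summable_iff_norm_sq_summable fun m =>
    ⟨b m • eigLp α β m, Submodule.smul_mem _ _ (Submodule.mem_span_singleton_self _)⟩).2 ?_
  · simpa using this
  · refine (hb.mul_right (K ^ 2)).of_nonneg_of_le (fun _ => by positivity) fun m => ?_
    rw [Submodule.coe_norm, norm_smul, mul_pow]
    gcongr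
    exact hK m

lemma inner_indicator_eq {x : ℝ} (hx : x ∈ Icc 0 Real.pi)
    (f : Lp ℂ 2 (volume.restrict (Ioo 0 Real.pi))) (g : ℝ → ℂ)
    (hfg : f =ᵐ[volume.restrict (Ioo 0 Real.pi)] g) :
    inner ℂ (indicatorConstLp 2 (measurableSet_Ioc (a := (0 : ℝ)) (b := x))
      (measure_ne_top (volume.restrict (Ioo 0 Real.pi)) _) (1 : ℂ)) f
      = ∫ t in (0 : ℝ)..x, g t := by
  rw [L2.inner_indicatorConstLp_one, intervalIntegral.integral_of_le hx.1,
    integral_congr_ae (ae_restrict_of_ae hfg), Measure.restrict_restrict measurableSet_Ioc]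
  apply setIntegral_congr_set
  have h : (Ioc 0 x ∩ Ioc 0 Real.pi : Set ℝ) = Ioc 0 x := by
    rw [inter_eq_left]; exact Ioc_subset_Ioc le_rfl hx.2
  have h2 : (Ioc 0 x ∩ Ioo 0 Real.pi : Set ℝ) =ᵐ[volume] (Ioc 0 x ∩ Ioc 0 Real.pi : Set ℝ) :=
    (ae_eq_refl _).inter Ioo_ae_eq_Ioc
  rwa [h] at h2

include hα hβ in
-- Pairing with the indicator of `(0, x]` is a continuous functional that evaluates the
-- antiderivative at `x`, so it carries the `L₂` sum to the required numerical series. The sum is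
-- extended by zero outside `(0, π)` to be integrable on the line.
lemma exists_hasExpansion {b : ℕ+ → ℂ} (hb : Summable fun m => ‖b m‖ ^ 2) :
    ∃ q, HasExpansion α β b q := by
  set f := ∑' m, b m • eigLp α β m with hf
  have hsum : HasSum (fun m => b m • eigLp α β m) f := (summable_smul_eigLp hα hβ hb).hasSum
  set q : ℝ → ℂ := (Ioo 0 Real.pi).indicator f with hq
  have hqf : (f : ℝ → ℂ) =ᵐ[volume.restrict (Ioo 0 Real.pi)] q :=
    (indicator_ae_eq_restrict measurableSet_Ioo).symm
  refine ⟨q, ?_, ?_, fun x hx => ?_⟩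
  · rw [hq, integrable_indicator_iff measurableSet_Ioo]
    exact (Lp.memLp f).integrable (by norm_num)
  · exact (memLp_congr_ae hqf).1 (Lp.memLp f)
  · have h := hsum.mapL (innerSL ℂ (indicatorConstLp 2 (measurableSet_Ioc (a := (0 : ℝ)) (b := x))
      (measure_ne_top (volume.restrict (Ioo 0 Real.pi)) _) (1 : ℂ)))
    simp only [innerSL_apply_apply, inner_smul_right] at h
    rw [inner_indicator_eq hx f q hqf] at h
    have e : ∀ m, _ = ∫ t in (0 : ℝ)..x, (eig α β m t : ℂ) := fun m =>
      inner_indicator_eq hx (eigLp α β m) _ (memLp_eig m).coeFn_toLp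
    simpa only [e] using h

include hα hβ in
/-- Potentials whose coefficients differ in exactly one place do not coincide. -/
lemma HasExpansion.not_ae_eq {b : ℕ+ → ℂ} {q₁ q₂ : ℝ → ℂ} {m : ℕ+}
    (h₁ : HasExpansion α β b q₁) (h₂ : HasExpansion α β (Function.update b m (b m + 1)) q₂) :
    ¬ q₁ =ᵐ[volume.restrict (Ioo 0 Real.pi)] q₂ := by
  intro hae
  -- Subtracting the two expansions leaves a single term, with coefficient `1`; differentiating its
  -- antiderivative then contradicts `exists_eig_ne_zero`.
  have hint : ∀ x ∈ Icc 0 Real.pi, ∫ t in (0 : ℝ)..x, (eig α β m t : ℂ) = 0 := by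
    intro x hx
    have e : ∫ t in (0 : ℝ)..x, q₁ t = ∫ t in (0 : ℝ)..x, q₂ t := by
      rw [intervalIntegral.integral_of_le hx.1, intervalIntegral.integral_of_le hx.1,
        integral_Ioc_eq_integral_Ioo, integral_Ioc_eq_integral_Ioo]
      exact integral_congr_ae (ae_restrict_of_ae_restrict_of_subset
        (Ioo_subset_Ioo le_rfl hx.2) hae)
    have h := (h₂.hasSum x hx).sub (h₁.hasSum x hx)
    rw [e, sub_self] at h
    have h' := hasSum_single (f := fun k => Function.update b m (b m + 1) k *
      (∫ t in (0 : ℝ)..x, (eig α β k t : ℂ)) - b k * ∫ t in (0 : ℝ)..x, (eig α β k t : ℂ)) m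
      (fun k hk => by simp [Function.update_of_ne hk])
    have := h'.unique h
    simp only [Function.update_self] at this
    linear_combination this
  obtain ⟨x, hx, hne⟩ := exists_eig_ne_zero hα hβ m
  have hd : HasDerivAt (fun x => ∫ t in (0 : ℝ)..x, (eig α β m t : ℂ)) (eig α β m x : ℂ) x :=
    ((Complex.continuous_ofReal.comp (continuous_eig m)).integral_hasStrictDerivAt 0 x).hasDerivAt
  have hz : (fun x => ∫ t in (0 : ℝ)..x, (eig α β m t : ℂ)) =ᶠ[𝓝 x] fun _ => 0 := by
    filter_upwards [Icc_mem_nhds hx.1 hx.2] with t ht using hint t ht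
  have := (hd.congr_of_eventuallyEq hz.symm).unique (hasDerivAt_const x (0 : ℂ))
  exact hne (by exact_mod_cast this)

end

/-! ### The resolvent series and the factorization of the characteristic function. -/

section
variable {α β : ℕ} (hα : α = 0 ∨ α = 1) (hβ : β = 0 ∨ β = 1)

lemma summable_one_div_pnat_sq : Summable fun m : ℕ+ => 1 / (m : ℝ) ^ 2 :=
  (Real.summable_one_div_nat_pow.2 one_lt_two).comp_injective PNat.coe_injective

include hα hβ in
lemma exists_sq_le_mul_norm {z : ℂ} (hz : ∀ m, (freq α β m : ℂ) ^ 2 ≠ z) :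
    ∃ K : ℝ, ∀ m : ℕ+, (m : ℝ) ^ 2 ≤ K * ‖(freq α β m : ℂ) ^ 2 - z‖ := by
  -- For `m > N + 1` the frequency is at least `m / 2` and `‖z‖ ≤ m² / 8`, so the distance to `z` is
  -- at least `m² / 8`; the remaining finitely many `m` are covered by `B`.
  obtain ⟨N, hN⟩ := exists_nat_ge (8 * ‖z‖ + 2)
  obtain ⟨B, hB⟩ := ((Set.finite_Iic (⟨N + 1, N.succ_pos⟩ : ℕ+)).image fun m : ℕ+ =>
    (m : ℝ) ^ 2 / ‖(freq α β m : ℂ) ^ 2 - z‖).bddAbove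
  refine ⟨max B 8, fun m => ?_⟩
  by_cases hm : m ≤ ⟨N + 1, N.succ_pos⟩
  · have h1 : 0 < ‖(freq α β m : ℂ) ^ 2 - z‖ := norm_pos_iff.2 (sub_ne_zero.2 (hz m))
    rw [← div_le_iff₀ h1]
    exact (hB ⟨m, hm, rfl⟩).trans (le_max_left _ _)
  · have hm' : N + 1 < (m : ℕ) := by
      have := lt_of_not_ge hm
      exact_mod_cast this
    have hm2 : (N : ℝ) + 1 < m := by exact_mod_cast hm'
    have h1 : (m : ℝ) / 2 ≤ freq α β m := by
      have := (freq_bounds hα hβ m).1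
      have := norm_nonneg z
      linarith
    have h2 : (freq α β m) ^ 2 - ‖z‖ ≤ ‖(freq α β m : ℂ) ^ 2 - z‖ := by
      have := norm_sub_norm_le ((freq α β m : ℂ) ^ 2) z
      rwa [norm_pow, Complex.norm_real, Real.norm_eq_abs, sq_abs] at this
    have hz0 := norm_nonneg z
    have h3 : (m : ℝ) ^ 2 ≤ 8 * ‖(freq α β m : ℂ) ^ 2 - z‖ := by nlinarith
    exact h3.trans (mul_le_mul_of_nonneg_right (le_max_right _ _) (norm_nonneg _))

include hα hβ in
-- The weight `1 + freq` is what termwise differentiation costs. The denominators grow like `m²`, so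
-- the terms are of size `‖b m‖ / m`, summable by `2 x y ≤ x² + y²`.
lemma summable_weighted {b : ℕ+ → ℂ} (hb : Summable fun m => ‖b m‖ ^ 2) {z : ℂ}
    (hz : ∀ m, (freq α β m : ℂ) ^ 2 ≠ z) :
    Summable fun m => ‖b m / ((freq α β m : ℂ) ^ 2 - z)‖ * (1 + freq α β m) := by
  obtain ⟨K, hK⟩ := exists_sq_le_mul_norm hα hβ hz
  refine ((hb.add summable_one_div_pnat_sq).mul_left K).of_nonneg_of_le
    (fun m => mul_nonneg (norm_nonneg _) (by linarith [freq_nonneg hα hβ m])) fun m => ?_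
  have h1 : 0 < ‖(freq α β m : ℂ) ^ 2 - z‖ := norm_pos_iff.2 (sub_ne_zero.2 (hz m))
  have hm : (1 : ℝ) ≤ m := Nat.one_le_cast.2 m.pos
  have h2 : 1 + freq α β m ≤ 2 * m := by linarith [(freq_bounds hα hβ m).2]
  have hK0 : 0 ≤ K := by
    by_contra h
    nlinarith [hK m]
  have h3 := hK m
  have hb0 := norm_nonneg (b m)
  rw [norm_div, div_mul_eq_mul_div, div_le_iff₀ h1]
  have h4 : ‖b m‖ * (2 * m) ≤ (‖b m‖ ^ 2 + 1 / (m : ℝ) ^ 2) * (m : ℝ) ^ 2 := by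
    have : (‖b m‖ ^ 2 + 1 / (m : ℝ) ^ 2) * (m : ℝ) ^ 2 = (‖b m‖ * m) ^ 2 + 1 := by
      field_simp
    rw [this]; nlinarith [sq_nonneg (‖b m‖ * m - 1)]
  calc ‖b m‖ * (1 + freq α β m) ≤ ‖b m‖ * (2 * m) := by gcongr
    _ ≤ (‖b m‖ ^ 2 + 1 / (m : ℝ) ^ 2) * (m : ℝ) ^ 2 := h4
    _ ≤ (‖b m‖ ^ 2 + 1 / (m : ℝ) ^ 2) * (K * ‖(freq α β m : ℂ) ^ 2 - z‖) := by gcongr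
    _ = _ := by ring

include hα hβ in
lemma summable_div_sub {b : ℕ+ → ℂ} (hb : Summable fun m => ‖b m‖ ^ 2) {z : ℂ}
    (hz : ∀ m, (freq α β m : ℂ) ^ 2 ≠ z) :
    Summable fun m => ‖b m / ((freq α β m : ℂ) ^ 2 - z)‖ :=
  (summable_weighted hα hβ hb hz).of_nonneg_of_le (fun _ => norm_nonneg _) fun m =>
    le_mul_of_one_le_right (norm_nonneg _) (by linarith [freq_nonneg hα hβ m])

/-- The characteristic function of the unperturbed problem. -/
def freeCharFun (α β : ℕ) (a : ℝ) : ℂ → ℂ :=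
  charFun α β (fun z x => cosSol z (x - a)) (solS a)

/-- The series `∑ b m * eig m / (μ m - z)` applied to the family `e`. -/
def resolventSeries (α β : ℕ) (b : ℕ+ → ℂ) (z : ℂ) (e : ℕ+ → ℝ → ℝ) (x : ℝ) : ℂ :=
  ∑' m, b m / ((freq α β m : ℂ) ^ 2 - z) * (e m x : ℂ)

lemma norm_term_le (b : ℕ+ → ℂ) (z : ℂ) (m : ℕ+) (x : ℝ) :
    ‖b m / ((freq α β m : ℂ) ^ 2 - z) * (eig α β m x : ℂ)‖
      ≤ ‖b m / ((freq α β m : ℂ) ^ 2 - z)‖ := by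
  rw [norm_mul, Complex.norm_real]
  exact mul_le_of_le_one_right (norm_nonneg _) (abs_eig_le m x)

include hα hβ in
lemma norm_term'_le (b : ℕ+ → ℂ) (z : ℂ) (m : ℕ+) (x : ℝ) :
    ‖b m / ((freq α β m : ℂ) ^ 2 - z) * (eig' α β m x : ℂ)‖
      ≤ ‖b m / ((freq α β m : ℂ) ^ 2 - z)‖ * (1 + freq α β m) := by
  rw [norm_mul, Complex.norm_real]
  gcongr
  exact (abs_eig'_le hα hβ m x).trans (by linarith)

section
variable {b : ℕ+ → ℂ} (hb : Summable fun m => ‖b m‖ ^ 2) {z : ℂ}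
  (hz : ∀ m, (freq α β m : ℂ) ^ 2 ≠ z)
include hα hβ hb hz

lemma summable_term (x : ℝ) :
    Summable fun m => b m / ((freq α β m : ℂ) ^ 2 - z) * (eig α β m x : ℂ) :=
  (summable_div_sub hα hβ hb hz).of_norm_bounded fun m => norm_term_le b z m x

lemma summable_term' (x : ℝ) :
    Summable fun m => b m / ((freq α β m : ℂ) ^ 2 - z) * (eig' α β m x : ℂ) :=
  (summable_weighted hα hβ hb hz).of_norm_bounded fun m => norm_term'_le hα hβ b z m x

lemma hasDerivAt_resolventSeries (x : ℝ) :
    HasDerivAt (resolventSeries α β b z (eig α β)) (resolventSeries α β b z (eig' α β) x) x :=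
  hasDerivAt_tsum (summable_weighted hα hβ hb hz)
    (fun m y => ((hasDerivAt_eig m y).ofReal_comp.const_mul _))
    (fun m y => norm_term'_le hα hβ b z m y) (summable_term hα hβ hb hz 0) x

/-- This is `E'' = -q - z E` in integrated form, coming termwise from `eig'' = -μ eig` and `μ / (μ -
z) = 1 + z / (μ - z)`. The integrated form is used because the expansion of `q` is known only
through antiderivatives. -/
lemma resolventSeries_deriv_eq {q : ℝ → ℂ} (hq : HasExpansion α β b q) {x : ℝ}
    (hx : x ∈ Icc 0 Real.pi) :
    resolventSeries α β b z (eig' α β) x = resolventSeries α β b z (eig' α β) 0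
      - (∫ t in (0 : ℝ)..x, q t)
      - z * ∫ t in (0 : ℝ)..x, resolventSeries α β b z (eig α β) t := by
  have h1 : HasSum (fun m => ∫ t in (0 : ℝ)..x,
      b m / ((freq α β m : ℂ) ^ 2 - z) * (eig α β m t : ℂ))
      (∫ t in (0 : ℝ)..x, resolventSeries α β b z (eig α β) t) := by
    refine intervalIntegral.hasSum_integral_of_dominated_convergence
      (fun m _ => ‖b m / ((freq α β m : ℂ) ^ 2 - z)‖) (fun m => ?_) (fun m => ?_) ?_ ?_ ?_
    · exact (continuous_const.mul
        (Complex.continuous_ofReal.comp (continuous_eig m))).aestronglyMeasurable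
    · exact ae_of_all _ fun t _ => norm_term_le b z m t
    · exact ae_of_all _ fun t _ => summable_div_sub hα hβ hb hz
    · exact intervalIntegrable_const
    · exact ae_of_all _ fun t _ => (summable_term hα hβ hb hz t).hasSum
  have h2 := (hq.hasSum x hx).add (h1.mul_left z)
  have h3 := (summable_term' hα hβ hb hz x).hasSum.sub (summable_term' hα hβ hb hz 0).hasSum
  have key : ∀ m, b m / ((freq α β m : ℂ) ^ 2 - z) * (eig' α β m x : ℂ)
      - b m / ((freq α β m : ℂ) ^ 2 - z) * (eig' α β m 0 : ℂ)
      = -(b m * (∫ t in (0 : ℝ)..x, (eig α β m t : ℂ)) + z * ∫ t in (0 : ℝ)..x,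
      b m / ((freq α β m : ℂ) ^ 2 - z) * (eig α β m t : ℂ)) := by
    intro m
    have hc : Continuous fun t => (eig α β m t : ℂ) :=
      Complex.continuous_ofReal.comp (continuous_eig m)
    have e : ∫ t in (0 : ℝ)..x, -((freq α β m : ℂ) ^ 2) * (eig α β m t : ℂ)
        = (eig' α β m x : ℂ) - (eig' α β m 0 : ℂ) :=
      intervalIntegral.integral_eq_sub_of_hasDerivAt (f := fun t => (eig' α β m t : ℂ))
        (fun t _ => (hasDerivAt_eig' m t).ofReal_comp.congr_deriv (by push_cast; ring))
        ((hc.const_mul _).intervalIntegrable _ _)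
    rw [intervalIntegral.integral_const_mul] at e
    rw [intervalIntegral.integral_const_mul, ← mul_sub, ← e]
    have := sub_ne_zero.2 (hz m)
    field_simp
    ring
  have h4 := h3.unique (by simpa only [key] using h2.neg)
  unfold resolventSeries at h4 ⊢
  linear_combination h4

/-- The function `y = (1 + E a) cos(√z (x - a)) - E x` solves the frozen equation with `y a = 1`, so
it may replace the first fundamental solution in the determinant. Since `E` satisfies both boundary
conditions, only `1 + E a` times the free solution contributes there. -/
lemma charFun_eq_mul {q : ℝ → ℂ} (hq : HasExpansion α β b q) {a : ℝ} (ha : a ∈ Icc 0 Real.pi) :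
    charFun α β (solC q a) (solS a) z
      = freeCharFun α β a z * (1 + resolventSeries α β b z (eig α β) a) := by
  set E := resolventSeries α β b z (eig α β) with hE
  set E' := resolventSeries α β b z (eig' α β) with hE'
  set y : ℝ → ℂ := fun x => (1 + E a) * cosSol z (x - a) - E x with hy
  set g : ℝ → ℂ := fun x => (1 + E a) * (-z * sinSol z (x - a)) - E' x with hg
  have hcd : ∀ x, HasDerivAt (fun x => cosSol z (x - a)) (-z * sinSol z (x - a)) x := fun x =>
    (hasDerivAt_cosSol z (x - a)).comp_sub_const x a
  have hyd : ∀ x, HasDerivAt y (g x) x := fun x =>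
    ((hcd x).const_mul (1 + E a)).sub (hasDerivAt_resolventSeries hα hβ hb hz x)
  have hEc : Continuous E := continuous_iff_continuousAt.2 fun x =>
    (hasDerivAt_resolventSeries hα hβ hb hz x).continuousAt
  have hcc : Continuous fun x => cosSol z (x - a) := continuous_iff_continuousAt.2 fun x =>
    (hcd x).continuousAt
  have hya : y a = 1 := by simp [hy]
  have hsol : IsSolution q a z y := by
    refine isSolution_of_hasDerivWithinAt (g := g) (fun x _ => (hyd x).hasDerivWithinAt)
      fun x hx => ?_
    have i1 : ∫ t in (0 : ℝ)..x, cosSol z (t - a) = sinSol z (x - a) - sinSol z (0 - a) :=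
      intervalIntegral.integral_eq_sub_of_hasDerivAt (f := fun t => sinSol z (t - a))
        (fun t _ => (hasDerivAt_sinSol z (t - a)).comp_sub_const t a)
        (hcc.intervalIntegrable _ _)
    have i2 : ∫ t in (0 : ℝ)..x, y t
        = (1 + E a) * (sinSol z (x - a) - sinSol z (0 - a)) - ∫ t in (0 : ℝ)..x, E t := by
      rw [← i1, ← intervalIntegral.integral_const_mul, ← intervalIntegral.integral_sub
        ((hcc.const_mul _).intervalIntegrable _ _) (hEc.intervalIntegrable _ _)]
    have hyc : Continuous y := continuous_iff_continuousAt.2 fun x => (hyd x).continuousAt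
    rw [hya]
    simp only [mul_one]
    rw [intervalIntegral.integral_sub hq.integrable.intervalIntegrable
      ((hyc.const_mul z).intervalIntegrable _ _), intervalIntegral.integral_const_mul, i2]
    have h := resolventSeries_deriv_eq hα hβ hb hz hq hx
    rw [← hE, ← hE'] at h
    simp only [hg, h]
    ring
  have hseries : ∀ (e : ℕ+ → ℝ → ℝ) (x : ℝ), (∀ m, e m x = 0) →
      resolventSeries α β b z e x = 0 := fun e x h => by simp [resolventSeries, h]
  have hd : ∀ m : ℕ, m = 0 ∨ m = 1 → ∀ x ∈ Icc 0 Real.pi, (m = 0 → E x = 0) →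
      (m = 1 → E' x = 0) →
      der m y x = (1 + E a) * der m (fun x => cosSol z (x - a)) x := by
    rintro m (rfl | rfl) x hx h0 h1
    · simp [hy, h0 rfl]
    · rw [der_one_eq hx (hyd x).hasDerivWithinAt, der_one_eq hx (hcd x).hasDerivWithinAt]
      simp [hg, h1 rfl]
  rw [charFun_eq_of_isSolution hα hβ hq.integrable ha (isFundamentalSystem_sol hq.integrable a ha)
    hsol hya, freeCharFun, charFun_eq,
    hd α hα 0 zero_mem_segment (fun h => hseries _ _ (eig_zero h))
      (fun h => hseries _ _ (eig'_zero h)),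
    hd β hβ _ pi_mem_segment (fun h => hseries _ _ (eig_pi hα h))
      (fun h => hseries _ _ (eig'_pi hα h))]
  ring

end

/-! ### Zeros of the unperturbed characteristic function -/

/-- The point `a` drops out by the addition formulas applied to `π = a + (π - a)`. -/
lemma freeCharFun_eq (a : ℝ) (z : ℂ) :
    freeCharFun 0 0 a z = sinSol z Real.pi ∧ freeCharFun 0 1 a z = cosSol z Real.pi ∧
    freeCharFun 1 0 a z = -cosSol z Real.pi ∧ freeCharFun 1 1 a z = z * sinSol z Real.pi := by
  have hcd : ∀ x ∈ Icc 0 Real.pi,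
      der 1 (fun x => cosSol z (x - a)) x = -z * sinSol z (x - a) := fun x hx =>
    der_one_eq hx ((hasDerivAt_cosSol z (x - a)).comp_sub_const x a).hasDerivWithinAt
  have hsd : ∀ x ∈ Icc 0 Real.pi, der 1 (solS a z) x = cosSol z (x - a) := fun x hx =>
    der_one_eq hx (hasDerivAt_solS a z x).hasDerivWithinAt
  have h1 := cosSol_add z a (Real.pi - a)
  have h2 := sinSol_add z a (Real.pi - a)
  rw [add_sub_cancel] at h1 h2
  refine ⟨?_, ?_, ?_, ?_⟩ <;>
  · simp only [freeCharFun, charFun_eq, hcd 0 zero_mem_segment, hcd _ pi_mem_segment,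
      hsd 0 zero_mem_segment, hsd _ pi_mem_segment, der_zero, solS, zero_sub, cosSol_neg,
      sinSol_neg, h1, h2]
    ring

lemma freq_sq_eq_iff_mul_pi {w z : ℂ} : w ^ 2 = z ↔ z * (Real.pi : ℂ) ^ 2 = (w * Real.pi) ^ 2 := by
  have : (Real.pi : ℂ) ^ 2 ≠ 0 := pow_ne_zero 2 (Complex.ofReal_ne_zero.2 Real.pi_ne_zero)
  rw [mul_pow]
  exact ⟨fun h => by rw [h], fun h => (mul_right_cancel₀ this h).symm⟩

include hα hβ in
lemma freeCharFun_zeros (a : ℝ) :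
    ∃ D' : ℂ → ℂ, (∀ z, HasDerivAt (freeCharFun α β a) (D' z) z) ∧
      (∀ z, freeCharFun α β a z = 0 ↔ ∃ m, (freq α β m : ℂ) ^ 2 = z) ∧
      ∀ z, freeCharFun α β a z = 0 → D' z ≠ 0 := by
  have hpi : (Real.pi : ℂ) ≠ 0 := Complex.ofReal_ne_zero.2 Real.pi_ne_zero
  have hlin : ∀ z : ℂ, HasDerivAt (fun z : ℂ => z * (Real.pi : ℂ) ^ 2) ((Real.pi : ℂ) ^ 2) z :=
    fun z => by simpa using (hasDerivAt_id z).mul_const ((Real.pi : ℂ) ^ 2)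
  have hcd : ∀ z : ℂ, HasDerivAt (fun z => cosSol z Real.pi)
      (-(sincSqrt (z * (Real.pi : ℂ) ^ 2)) / 2 * (Real.pi : ℂ) ^ 2) z := fun z =>
    (hasDerivAt_cosSqrt _).comp z (hlin z)
  have hsd : ∀ z : ℂ, HasDerivAt (fun z => sinSol z Real.pi)
      (Real.pi * (deriv sincSqrt (z * (Real.pi : ℂ) ^ 2) * (Real.pi : ℂ) ^ 2)) z := fun z =>
    ((differentiable_sincSqrt _).hasDerivAt.comp z (hlin z)).const_mul _
  have hc0 : ∀ z : ℂ, cosSol z Real.pi = 0 ↔ ∃ m : ℕ+, ((m : ℂ) - 1 / 2) ^ 2 = z := fun z => by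
    simp only [freq_sq_eq_iff_mul_pi]
    exact cosSqrt_eq_zero_iff _
  have hs0' : ∀ z : ℂ, sinSol z Real.pi = 0 ↔ sincSqrt (z * (Real.pi : ℂ) ^ 2) = 0 := fun z => by
    simp [sinSol, hpi]
  have hs0 : ∀ z : ℂ, sinSol z Real.pi = 0 ↔ ∃ m : ℕ+, (m : ℂ) ^ 2 = z := fun z => by
    simp only [freq_sq_eq_iff_mul_pi, hs0']
    exact sincSqrt_eq_zero_iff _
  have hcne : ∀ z : ℂ, cosSol z Real.pi = 0 →
      -(sincSqrt (z * (Real.pi : ℂ) ^ 2)) / 2 * (Real.pi : ℂ) ^ 2 ≠ 0 := by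
    intro z h
    have h1 := cosSol_sq_add z Real.pi
    intro h2
    have h3 : sincSqrt (z * (Real.pi : ℂ) ^ 2) = 0 := by simpa [hpi] using h2
    simp [h, sinSol, h3] at h1
  have hsne : ∀ z : ℂ, sinSol z Real.pi = 0 →
      z * (Real.pi * (deriv sincSqrt (z * (Real.pi : ℂ) ^ 2) * (Real.pi : ℂ) ^ 2)) ≠ 0 := by
    intro z h
    have h1 := deriv_sincSqrt_ne_zero ((hs0' z).1 h)
    have h2 := mul_ne_zero hpi h1
    intro h3
    apply h2
    linear_combination h3
  have hfree := freeCharFun_eq a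
  rcases hα with rfl | rfl <;> rcases hβ with rfl | rfl
  · have e : freeCharFun 0 0 a = fun z => sinSol z Real.pi := funext fun z => (hfree z).1
    rw [e]
    refine ⟨_, hsd, fun z => ?_, fun z h => right_ne_zero_of_mul (hsne z h)⟩
    simpa [freq] using hs0 z
  · have e : freeCharFun 0 1 a = fun z => cosSol z Real.pi := funext fun z => (hfree z).2.1
    rw [e]
    refine ⟨_, hcd, fun z => ?_, fun z h => hcne z h⟩
    simpa [freq] using hc0 z
  · have e : freeCharFun 1 0 a = fun z => -cosSol z Real.pi := funext fun z => (hfree z).2.2.1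
    rw [e]
    refine ⟨_, fun z => (hcd z).neg, fun z => ?_, fun z h => neg_ne_zero.2 (hcne z (neg_eq_zero.1 h))⟩
    simpa [freq] using hc0 z
  · have e : freeCharFun 1 1 a = fun z => z * sinSol z Real.pi := funext fun z => (hfree z).2.2.2
    rw [e]
    refine ⟨_, fun z => (hasDerivAt_id z).mul (hsd z), fun z => ?_, fun z h => ?_⟩
    -- Here the frequencies are `m - 1`: the factor `z` accounts for `m = 1`, the zeros of the sine
    -- for `m ≥ 2`.
    · rw [mul_eq_zero, hs0]
      have hf : ∀ m : ℕ+, (freq 1 1 m : ℂ) = (m : ℂ) - 1 := fun m => by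
        simp only [freq]; push_cast; ring
      simp only [hf]
      constructor
      · rintro (rfl | ⟨m, rfl⟩)
        · exact ⟨1, by simp⟩
        · exact ⟨m + 1, by push_cast; ring⟩
      · rintro ⟨m, rfl⟩
        by_cases hm : m = 1
        · left; simp [hm]
        · right
          obtain ⟨n, rfl⟩ := PNat.exists_eq_succ_of_ne_one hm
          exact ⟨n, by push_cast; ring⟩
    · rcases mul_eq_zero.1 h with h0 | h0
      · subst h0
        simp [sinSol, sincSqrt_zero, Real.pi_ne_zero]
      · simpa [h0] using hsne z h0

include hα hβ in
lemma freeCharFun_order (a : ℝ) :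
    Differentiable ℂ (freeCharFun α β a) ∧
      ∀ z, {m | (freq α β m : ℂ) ^ 2 = z}.encard = analyticOrderAt (freeCharFun α β a) z := by
  obtain ⟨D', hd, hzero, hne⟩ := freeCharFun_zeros hα hβ a
  have hD : Differentiable ℂ (freeCharFun α β a) := fun z => (hd z).differentiableAt
  refine ⟨hD, fun z => ?_⟩
  have han := hD.analyticAt z
  by_cases h : freeCharFun α β a z = 0
  · obtain ⟨m, hm⟩ := (hzero z).1 h
    have h1 := han.analyticOrderAt_sub_eq_one_of_deriv_ne_zero (by rw [(hd z).deriv]; exact hne z h)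
    simp only [h, sub_zero] at h1
    rw [h1, Set.encard_eq_one]
    refine ⟨m, ?_⟩
    ext n
    simp only [mem_ofPred_eq, mem_singleton_iff]
    constructor
    · intro hn
      exact freq_sq_cast_injective hα hβ (hn.trans hm.symm)
    · rintro rfl; exact hm
  · rw [han.analyticOrderAt_eq_zero.2 h, Set.encard_eq_zero, Set.eq_empty_iff_forall_notMem]
    exact fun m hm => h ((hzero z).2 ⟨m, hm⟩)

end

section
variable {α β : ℕ} (hα : α = 0 ∨ α = 1) (hβ : β = 0 ∨ β = 1)

/-! ### The deviations of the prescribed spectrum -/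

/-- The deviation of the prescribed spectrum from the unperturbed one. -/
def deviation (α β : ℕ) (lam : ℕ+ → ℂ) (m : ℕ+) : ℂ := lam m - (freq α β m : ℂ) ^ 2

include hα hβ in
-- Expanding the square, the deviation is `κ m * (2 * freq / m + κ m / m²)`, and the bracket is
-- bounded because `freq ≤ m` and `κ` is bounded.
lemma summable_deviation {lam : ℕ+ → ℂ} (h : HasAsymptotics α β lam) :
    Summable fun m => ‖deviation α β lam m‖ ^ 2 := by
  obtain ⟨κ, hκ, hlam⟩ := h
  have hs : Summable fun m => ‖κ m‖ ^ 2 := by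
    have := (memℓp_gen_iff (p := 2) (by norm_num)).1 hκ
    simpa using this
  obtain ⟨B, hB⟩ := (hκ.of_exponent_ge le_top : Memℓp κ ⊤).bddAbove
  have hB' : ∀ m, ‖κ m‖ ≤ B := fun m => hB ⟨m, rfl⟩
  refine (hs.mul_right ((2 + B) ^ 2)).of_nonneg_of_le (fun _ => by positivity) fun m => ?_
  rw [← mul_pow]
  gcongr
  have hm : (1 : ℝ) ≤ m := Nat.one_le_cast.2 m.pos
  have hmc : (m : ℂ) ≠ 0 := by exact_mod_cast m.ne_zero
  have e : deviation α β lam m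
      = κ m * (2 * ((freq α β m : ℂ) / m) + κ m / (m : ℂ) ^ 2) := by
    rw [deviation, hlam, freq]
    push_cast
    field_simp
    ring
  rw [e, norm_mul]
  gcongr
  refine (norm_add_le _ _).trans (add_le_add ?_ ?_)
  · have h1 : ‖(freq α β m : ℂ) / m‖ ≤ 1 := by
      rw [norm_div, Complex.norm_real, Complex.norm_natCast, Real.norm_eq_abs,
        abs_of_nonneg (freq_nonneg hα hβ m)]
      exact div_le_one_of_le₀ (freq_bounds hα hβ m).2 (by positivity)
    rw [norm_mul, Complex.norm_ofNat]
    linarith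
  · rw [norm_div, norm_pow, Complex.norm_natCast]
    exact (div_le_self (norm_nonneg _) (one_le_pow₀ hm)).trans (hB' m)

include hα hβ in
-- For nonnegative frequencies the sum dominates the difference, so `|μ n - μ m| ≥ (n - m)²`. With
-- `d` bounded by `B`, every such sum is at most `B ∑ 1 / j²` over the integers, whatever `m` is;
-- the term `j = 0` is zero by the convention for division.
lemma exists_tsum_le {d : ℕ+ → ℂ} (hd : Summable fun m => ‖d m‖ ^ 2) :
    ∃ M : ℝ, ∀ m,
      Summable (fun n => ‖d n / ((freq α β n : ℂ) ^ 2 - (freq α β m : ℂ) ^ 2)‖) ∧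
      ∑' n, ‖d n / ((freq α β n : ℂ) ^ 2 - (freq α β m : ℂ) ^ 2)‖ ≤ M := by
  have hbd : ∃ B : ℝ, 0 ≤ B ∧ ∀ m, ‖d m‖ ≤ B := by
    refine ⟨1 + ∑' m, ‖d m‖ ^ 2, by positivity, fun m => ?_⟩
    have := hd.le_tsum m fun _ _ => by positivity
    nlinarith [sq_nonneg (‖d m‖ - 1), norm_nonneg (d m)]
  obtain ⟨B, hB0, hB⟩ := hbd
  have hsz : Summable fun j : ℤ => B * (1 / (j : ℝ) ^ 2) :=
    (Real.summable_one_div_int_pow.2 one_lt_two).mul_left B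
  refine ⟨∑' j : ℤ, B * (1 / (j : ℝ) ^ 2), fun m => ?_⟩
  have hinj : Function.Injective fun n : ℕ+ => (n : ℤ) - (m : ℤ) := fun n n' h => by
    have h' : (n : ℤ) - (m : ℤ) = (n' : ℤ) - (m : ℤ) := h
    exact PNat.coe_injective (by omega)
  have hle : ∀ n, ‖d n / ((freq α β n : ℂ) ^ 2 - (freq α β m : ℂ) ^ 2)‖
      ≤ B * (1 / (((n : ℤ) - (m : ℤ) : ℤ) : ℝ) ^ 2) := by
    intro n
    by_cases hnm : n = m
    · subst hnm; simp
    have hx : ((((n : ℤ) - (m : ℤ) : ℤ) : ℝ)) = freq α β n - freq α β m := by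
      unfold freq; push_cast; ring
    have hne : freq α β n - freq α β m ≠ 0 := fun h0 => hnm
      (freq_sq_injective hα hβ (by simp only [sub_eq_zero.1 h0]))
    have hden : (freq α β n - freq α β m) ^ 2
        ≤ ‖(freq α β n : ℂ) ^ 2 - (freq α β m : ℂ) ^ 2‖ := by
      have e : (freq α β n : ℂ) ^ 2 - (freq α β m : ℂ) ^ 2
          = (((freq α β n - freq α β m) * (freq α β n + freq α β m) : ℝ) : ℂ) := by
        push_cast; ring
      rw [e, Complex.norm_real, Real.norm_eq_abs, abs_mul, ← sq_abs, sq]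
      refine mul_le_mul_of_nonneg_left ?_ (abs_nonneg _)
      have h1 := freq_nonneg hα hβ n
      have h2 := freq_nonneg hα hβ m
      rw [abs_of_nonneg (add_nonneg h1 h2)]
      exact abs_le.2 ⟨by linarith, by linarith⟩
    rw [hx, norm_div, mul_one_div]
    have : 0 < (freq α β n - freq α β m) ^ 2 := by positivity
    exact div_le_div₀ hB0 (hB n) this hden
  have hsum := hsz.comp_injective hinj
  have h1 : Summable (fun n => ‖d n / ((freq α β n : ℂ) ^ 2 - (freq α β m : ℂ) ^ 2)‖) :=
    hsum.of_nonneg_of_le (fun _ => norm_nonneg _) hle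
  exact ⟨h1, (h1.tsum_le_tsum hle hsum).trans
    (tsum_comp_le_tsum_of_inj hsz (fun _ => by positivity) hinj)⟩

include hα hβ in
lemma tendsto_norm_freq_sq :
    Tendsto (fun m => ‖(freq α β m : ℂ) ^ 2‖) cofinite atTop := by
  have h : Tendsto (fun m : ℕ+ => (m : ℝ)) cofinite atTop := by
    have := PNat.coe_injective.tendsto_cofinite
    rw [Nat.cofinite_eq_atTop] at this
    exact tendsto_natCast_atTop_atTop.comp this
  refine tendsto_atTop_mono (fun m => ?_) (tendsto_atTop_add_const_right _ (-2) h)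
  rw [norm_pow, Complex.norm_real, Real.norm_eq_abs, sq_abs]
  nlinarith [(freq_bounds hα hβ m).1, sq_nonneg (freq α β m - 1)]

/-- The coefficients that the values at the point `a` of the terms of the potential must have. -/
def targetCoeff (α β : ℕ) (lam : ℕ+ → ℂ) (m : ℕ+) : ℂ :=
  fractionCoeff (fun m => (freq α β m : ℂ) ^ 2) (deviation α β lam) m

include hα hβ in
lemma summable_targetCoeff {lam : ℕ+ → ℂ} (h : HasAsymptotics α β lam) :
    Summable fun m => ‖targetCoeff α β lam m‖ ^ 2 := by
  have hd := summable_deviation hα hβ h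
  obtain ⟨M, hM⟩ := exists_tsum_le hα hβ hd
  refine (hd.mul_left (Real.exp M ^ 2)).of_nonneg_of_le (fun _ => by positivity) fun m => ?_
  rw [← mul_pow]
  gcongr
  exact norm_fractionCoeff_le hM m

include hα hβ in
/-- A potential with suitable coefficients has the prescribed spectrum. -/
lemma HasExpansion.isSpectrum {lam : ℕ+ → ℂ} (h : HasAsymptotics α β lam) {a : ℝ}
    (ha : a ∈ Icc 0 Real.pi) {b : ℕ+ → ℂ} (hb : Summable fun m => ‖b m‖ ^ 2)
    (hba : ∀ m, b m * (eig α β m a : ℂ) = targetCoeff α β lam m) {q : ℝ → ℂ}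
    (hq : HasExpansion α β b q) : IsSpectrum q a α β lam := by
  have hd := summable_deviation hα hβ h
  obtain ⟨M, hM⟩ := exists_tsum_le hα hβ hd
  obtain ⟨hD, hord⟩ := freeCharFun_order hα hβ a
  have hCS := isFundamentalSystem_sol hq.integrable a ha
  have hFD : ∀ z, (∀ m, (freq α β m : ℂ) ^ 2 ≠ z) →
      charFun α β (solC q a) (solS a) z = freeCharFun α β a z *
        ∏' n, (1 + (lam n - (freq α β n : ℂ) ^ 2) / ((freq α β n : ℂ) ^ 2 - z)) := by
    intro z hz
    have e := tprod_eq_one_add_tsum hM (freq_sq_cast_injective hα hβ) hz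
      (summable_div_sub hα hβ hd hz)
    unfold deviation at e
    rw [charFun_eq_mul hα hβ hb hz hq ha, e, resolventSeries]
    congr 2
    refine tsum_congr fun m => ?_
    rw [div_mul_eq_mul_div, hba m]
    rfl
  have hds : Summable fun n => ‖lam n - (freq α β n : ℂ) ^ 2‖ / (1 + ‖(freq α β n : ℂ) ^ 2‖) := by
    -- Since `μ m ≥ 0`, the weight `1 + ‖μ m‖` is the distance from `μ m` to `-1`, and the estimate
    -- at `z = -1` applies.
    have hne : ∀ m, (freq α β m : ℂ) ^ 2 ≠ -1 := by
      intro m hm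
      have h1 : (freq α β m) ^ 2 = -1 := by exact_mod_cast hm
      nlinarith [sq_nonneg (freq α β m)]
    refine (summable_div_sub hα hβ hd hne).congr fun m => ?_
    rw [norm_div]
    congr 1
    have e : (freq α β m : ℂ) ^ 2 - -1 = ((1 + freq α β m ^ 2 : ℝ) : ℂ) := by push_cast; ring
    rw [e, Complex.norm_real, norm_pow, Complex.norm_real, Real.norm_eq_abs, Real.norm_eq_abs,
      sq_abs, abs_of_nonneg (by positivity)]
  have key := analyticAt_and_order_of_eq_mul_tprod
    (continuous_charFun hq.integrable a hα hβ) hD (tendsto_norm_freq_sq hα hβ) hds hord hFD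
  refine ⟨?_, _, _, hCS, fun z => (key z).2⟩
  ext z
  rw [mem_ofPred_eq, isEigenvalue_iff hα hβ hq.integrable ha hCS z,
    ← (key z).1.analyticOrderAt_ne_zero, ← (key z).2, Set.encard_ne_zero]
  rfl

/-! ### The values of the eigenfunctions at the frozen point -/

/-- Raising `m` by `2k` changes the argument at `π / k` by `2π`. Hence the nonzero values are
bounded away from zero, which keeps the coefficients square summable after division. -/
lemma finite_range_eig (k : ℕ+) :
    (range fun m => eig α β m (Real.pi / (k : ℝ))).Finite := by
  have hk : (k : ℝ) ≠ 0 := by exact_mod_cast k.ne_zero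
  refine ((Finset.range (2 * k)).finite_toSet.image fun j : ℕ =>
    if α = 0 then Real.sin (((j : ℝ) - ((α : ℝ) + β) / 2) * (Real.pi / k))
    else Real.cos (((j : ℝ) - ((α : ℝ) + β) / 2) * (Real.pi / k))).subset ?_
  rintro _ ⟨m, rfl⟩
  refine ⟨(m : ℕ) % (2 * k), by simpa using Nat.mod_lt _ (by positivity), ?_⟩
  have e : freq α β m * (Real.pi / k)
      = ((((m : ℕ) % (2 * k) : ℕ) : ℝ) - ((α : ℝ) + β) / 2) * (Real.pi / k)
        + ((m : ℕ) / (2 * k) : ℕ) * (2 * Real.pi) := by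
    have h : (m : ℝ) = (((m : ℕ) % (2 * k) : ℕ) : ℝ) + 2 * k * ((m : ℕ) / (2 * k) : ℕ) := by
      exact_mod_cast (Nat.mod_add_div (m : ℕ) (2 * k)).symm
    unfold freq
    rw [h]
    field_simp
    ring
  simp only [eig, e, Real.sin_add_nat_mul_two_pi, Real.cos_add_nat_mul_two_pi]

lemma exists_norm_inv_eig_le (k : ℕ+) :
    ∃ M : ℝ, ∀ m, ‖((eig α β m (Real.pi / (k : ℝ)) : ℂ))⁻¹‖ ≤ M := by
  obtain ⟨M, hM⟩ := ((finite_range_eig (α := α) (β := β) k).image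
    fun x : ℝ => ‖((x : ℂ))⁻¹‖).bddAbove
  exact ⟨M, fun m => hM ⟨_, ⟨m, rfl⟩, rfl⟩⟩

lemma eig_eq_zero_iff_of_sin (k m : ℕ+) :
    eig 0 β m (Real.pi / (k : ℝ)) = 0 ↔ ∃ j : ℤ, 2 * (m : ℤ) - β = 2 * (k * j) := by
  have hk : (k : ℝ) ≠ 0 := by exact_mod_cast k.ne_zero
  have hpi := Real.pi_ne_zero
  simp only [eig, if_true, Real.sin_eq_zero_iff]
  refine exists_congr fun j => ?_
  have e : ((j : ℝ) * Real.pi = freq 0 β m * (Real.pi / k))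
      ↔ 2 * (m : ℝ) - β = 2 * (k * j) := by
    unfold freq
    push_cast
    rw [← mul_div_assoc, eq_div_iff hk]
    constructor
    · intro h
      apply mul_right_cancel₀ hpi
      linear_combination (-2) * h
    · intro h
      linear_combination (-Real.pi / 2) * h
  rw [e]
  exact_mod_cast Iff.rfl

lemma eig_eq_zero_iff_of_cos (k m : ℕ+) :
    eig 1 β m (Real.pi / (k : ℝ)) = 0 ↔ ∃ j : ℤ, 2 * (m : ℤ) - (1 + β) = k * (2 * j + 1) := by
  have hk : (k : ℝ) ≠ 0 := by exact_mod_cast k.ne_zero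
  have hpi := Real.pi_ne_zero
  simp only [eig, one_ne_zero, if_false, Real.cos_eq_zero_iff]
  refine exists_congr fun j => ?_
  have e : (freq 1 β m * (Real.pi / k) = (2 * (j : ℝ) + 1) * Real.pi / 2)
      ↔ 2 * (m : ℝ) - (1 + β) = k * (2 * j + 1) := by
    unfold freq
    push_cast
    rw [← mul_div_assoc, div_eq_div_iff hk two_ne_zero]
    constructor
    · intro h
      apply mul_right_cancel₀ hpi
      linear_combination h
    · intro h
      linear_combination Real.pi * h
  rw [e]
  exact_mod_cast Iff.rfl

/-- In each of the three cases the integer equation for a zero equates an odd number with an even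
one. -/
lemma NonDegenerate.eig_ne_zero {k : ℕ+} (h : NonDegenerate α β k) (m : ℕ+) :
    eig α β m (Real.pi / (k : ℝ)) ≠ 0 := by
  rcases h with ⟨rfl, rfl⟩ | ⟨rfl, rfl, hk⟩ | ⟨rfl, rfl, hk⟩
  · rw [Ne, eig_eq_zero_iff_of_sin]
    rintro ⟨j, hj⟩
    push_cast at hj
    omega
  · rw [Ne, eig_eq_zero_iff_of_cos]
    rintro ⟨j, hj⟩
    obtain ⟨r, hr⟩ := hk
    rw [hr] at hj
    push_cast at hj
    have : 2 * (m : ℤ) - (1 + 0) = 2 * (r * (2 * j + 1)) := by linear_combination hj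
    omega
  · rw [Ne, eig_eq_zero_iff_of_cos]
    rintro ⟨j, hj⟩
    obtain ⟨r, hr⟩ := hk
    rw [hr] at hj
    push_cast at hj
    have : 2 * (m : ℤ) - (1 + 1) = 2 * (r * (2 * j + 1) + j) + 1 := by linear_combination hj
    omega

lemma Degenerate.deviation_eq_zero {k : ℕ+} (h : Degenerate α β k) {lam : ℕ+ → ℂ}
    (hc : DegenerationCondition α β k lam) {m : ℕ+}
    (hm : eig α β m (Real.pi / (k : ℝ)) = 0) : deviation α β lam m = 0 := by
  have hkpos : (0 : ℤ) < k := by exact_mod_cast k.pos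
  have hmpos : (1 : ℤ) ≤ m := by exact_mod_cast m.pos
  -- The left side is nonnegative, so `j ≥ 0`; the shift `n = j + 1` passes from `2j + 1` to the `2n
  -- - 1` of the degeneration condition.
  have hcos : ∀ (b : ℕ) (j : ℤ), b ≤ 1 → 2 * (m : ℤ) - (1 + b) = k * (2 * j + 1) →
      ∃ n : ℕ+, (n : ℤ) = j + 1 := by
    intro b j hb hj
    have hj0 : 0 ≤ j := by
      by_contra! hneg
      have : (k : ℤ) * (2 * j + 1) ≤ k * (-1) := by gcongr; omega
      omega
    exact ⟨⟨(j + 1).toNat, by omega⟩, Int.toNat_of_nonneg (by omega)⟩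
  rcases h with ⟨rfl, rfl⟩ | ⟨rfl, rfl, hk⟩ | ⟨rfl, rfl, hk⟩
  · obtain ⟨j, hj⟩ := (eig_eq_zero_iff_of_sin k m).1 hm
    have hj0 : 0 < j := by
      by_contra! hneg
      have : (k : ℤ) * j ≤ 0 := mul_nonpos_of_nonneg_of_nonpos hkpos.le hneg
      push_cast at hj
      omega
    obtain ⟨n, rfl⟩ : ∃ n : ℕ+, (n : ℤ) = j :=
      ⟨⟨j.toNat, by omega⟩, Int.toNat_of_nonneg hj0.le⟩
    have hmk : m = k * n := by
      apply PNat.coe_injective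
      have : (m : ℤ) = k * n := by push_cast at hj; omega
      push_cast
      exact_mod_cast this
    rw [deviation, hmk, hc.1 ⟨rfl, rfl⟩, freq]
    push_cast; ring
  · obtain ⟨j, hj⟩ := (eig_eq_zero_iff_of_cos k m).1 hm
    obtain ⟨n, hn⟩ := hcos 0 j zero_le_one hj
    obtain rfl : j = n - 1 := by omega
    have e : 2 * (m : ℤ) = k * (2 * n - 1) + 1 := by push_cast at hj; linear_combination hj
    have e' : 2 * (m : ℂ) = k * (2 * n - 1) + 1 := by exact_mod_cast congrArg (Int.cast : ℤ → ℂ) e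
    rw [deviation, hc.2.1 ⟨rfl, rfl, hk⟩ n m e, freq]
    push_cast
    have e2 : (m : ℂ) = (k * (2 * n - 1) + 1) / 2 := by rw [← e']; ring
    rw [e2]; ring
  · obtain ⟨j, hj⟩ := (eig_eq_zero_iff_of_cos k m).1 hm
    obtain ⟨n, hn⟩ := hcos 1 j le_rfl hj
    obtain rfl : j = n - 1 := by omega
    have e : 2 * (m : ℤ) = k * (2 * n - 1) + 2 := by push_cast at hj; linear_combination hj
    have e' : 2 * (m : ℂ) = k * (2 * n - 1) + 2 := by exact_mod_cast congrArg (Int.cast : ℤ → ℂ) e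
    rw [deviation, hc.2.2 ⟨rfl, rfl, hk⟩ n m e, freq]
    push_cast
    have e2 : (m : ℂ) = (k * (2 * n - 1) + 2) / 2 := by rw [← e']; ring
    rw [e2]; ring

/-- Such an index marks a coefficient of the potential that does not affect the spectrum. -/
lemma Degenerate.exists_eig_eq_zero {k : ℕ+} (h : Degenerate α β k) :
    ∃ m, eig α β m (Real.pi / (k : ℝ)) = 0 := by
  rcases h with ⟨rfl, rfl⟩ | ⟨rfl, rfl, r, hr⟩ | ⟨rfl, rfl, r, hr⟩
  · exact ⟨k, (eig_eq_zero_iff_of_sin k k).2 ⟨1, by push_cast; ring⟩⟩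
  · exact ⟨⟨r + 1, r.succ_pos⟩, (eig_eq_zero_iff_of_cos k _).2 ⟨0, by
      rw [hr]; push_cast [PNat.mk_coe]; ring⟩⟩
  · exact ⟨⟨r + 1, r.succ_pos⟩, (eig_eq_zero_iff_of_cos k _).2 ⟨0, by
      rw [hr]; push_cast [PNat.mk_coe]; ring⟩⟩

include hα hβ in
/-- If the deviations vanish wherever the eigenfunctions vanish at `π / k`, then there are
square summable coefficients with the target values. -/
lemma exists_coeff {k : ℕ+} {lam : ℕ+ → ℂ} (h : HasAsymptotics α β lam)
    (hz : ∀ m, eig α β m (Real.pi / (k : ℝ)) = 0 → deviation α β lam m = 0) :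
    ∃ b : ℕ+ → ℂ, (Summable fun m => ‖b m‖ ^ 2) ∧
      ∀ m, b m * (eig α β m (Real.pi / (k : ℝ)) : ℂ) = targetCoeff α β lam m := by
  obtain ⟨M, hM⟩ := exists_norm_inv_eig_le (α := α) (β := β) k
  -- Where the eigenfunction vanishes, `0⁻¹ = 0` sets the coefficient to zero; the equation holds
  -- there because the target carries the factor `deviation α β lam m = 0`.
  refine ⟨fun m => targetCoeff α β lam m * (eig α β m (Real.pi / (k : ℝ)) : ℂ)⁻¹, ?_, fun m => ?_⟩
  · refine ((summable_targetCoeff hα hβ h).mul_right (M ^ 2)).of_nonneg_of_le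
      (fun _ => by positivity) fun m => ?_
    rw [norm_mul, mul_pow]
    gcongr
    exact hM m
  · by_cases h0 : eig α β m (Real.pi / (k : ℝ)) = 0
    · simp [h0, targetCoeff, fractionCoeff, hz m h0]
    · rw [inv_mul_cancel_right₀ (Complex.ofReal_ne_zero.2 h0)]

lemma pi_div_mem_segment (k : ℕ+) : Real.pi / (k : ℝ) ∈ Icc 0 Real.pi :=
  ⟨by positivity, div_le_self Real.pi_pos.le (Nat.one_le_cast.2 k.pos)⟩

end

end
end FrozenSL

open FrozenSL in
theorem theorem4p2 (α β : ℕ) (k : ℕ+) (lam : ℕ+ → ℂ)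
    (hlam : FrozenSL.HasAsymptotics α β lam) :
    (FrozenSL.NonDegenerate α β k →
      ∃ q : ℝ → ℂ, FrozenSL.IsL2 q ∧
        FrozenSL.IsSpectrum q (Real.pi / (k : ℝ)) α β lam) ∧
    (FrozenSL.Degenerate α β k → FrozenSL.DegenerationCondition α β k lam →
      ∃ q₁ q₂ : ℝ → ℂ, FrozenSL.IsL2 q₁ ∧ FrozenSL.IsL2 q₂ ∧
        ¬ q₁ =ᵐ[volume.restrict (Ioo 0 Real.pi)] q₂ ∧
        FrozenSL.IsSpectrum q₁ (Real.pi / (k : ℝ)) α β lam ∧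
        FrozenSL.IsSpectrum q₂ (Real.pi / (k : ℝ)) α β lam) := by
  have ha := pi_div_mem_segment k
  constructor
  · intro h
    have hα : α = 0 ∨ α = 1 := by unfold NonDegenerate at h; tauto
    have hβ : β = 0 ∨ β = 1 := by unfold NonDegenerate at h; tauto
    obtain ⟨b, hb, hba⟩ := exists_coeff hα hβ hlam fun m hm => absurd hm (h.eig_ne_zero m)
    obtain ⟨q, hq⟩ := exists_hasExpansion hα hβ hb
    exact ⟨q, hq.isL2, hq.isSpectrum hα hβ hlam ha hb hba⟩
  · intro h hc
    have hα : α = 0 ∨ α = 1 := by unfold Degenerate at h; tauto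
    have hβ : β = 0 ∨ β = 1 := by unfold Degenerate at h; tauto
    obtain ⟨b, hb, hba⟩ := exists_coeff hα hβ hlam fun m hm => h.deviation_eq_zero hc hm
    -- The equation at this `m` reads `b m * 0 = 0`, so `b m` may be changed to `b m + 1` to produce
    -- a second potential.
    obtain ⟨m, hm⟩ := h.exists_eig_eq_zero
    have hb' : Summable fun n => ‖Function.update b m (b m + 1) n‖ ^ 2 := by
      refine (hb.update m (‖b m + 1‖ ^ 2)).congr fun n => ?_
      by_cases hn : n = m
      · subst hn; simp
      · simp [Function.update_of_ne hn]
    have hba' : ∀ n, Function.update b m (b m + 1) n * (eig α β n (Real.pi / (k : ℝ)) : ℂ)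
        = targetCoeff α β lam n := by
      intro n
      by_cases hn : n = m
      · subst hn; rw [← hba n, hm]; simp
      · rw [Function.update_of_ne hn, hba n]
    obtain ⟨q₁, h₁⟩ := exists_hasExpansion hα hβ hb
    obtain ⟨q₂, h₂⟩ := exists_hasExpansion hα hβ hb'
    exact ⟨q₁, q₂, h₁.isL2, h₂.isL2, h₁.not_ae_eq hα hβ h₂,
      h₁.isSpectrum hα hβ hlam ha hb hba, h₂.isSpectrum hα hβ hlam ha hb' hba'⟩
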